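/- Let $k,d\ge 1$ and let $\Omega\subset\mathbb R^k$ and $\mathcal S\subset\mathbb R^d$ be open, connected, bounded sets with smooth boundary. Let $\mathcal P_{\mathrm{a.c.}}(\Omega)$ be the set of probability measures on $\Omega$ that are absolutely continuous with respect to Lebesgue measure, with the $2$-Wasserstein distance $d_{W_2}(\mu,\nu)=\inf_{\pi}\big(\int|x-y|^2\,d\pi(x,y)\big)^{1/2}$ (infimum over all couplings $\pi$ of $\mu$ and $\nu$). Let $\Lambda\subset\mathcal P_{\mathrm{a.c.}}(\Omega)$ and let $E:\mathcal S\to\Lambda$ be surjective and bi-Lipschitz, for the Euclidean distance on $\mathcal S$ and $d_{W_2}$ on $\Lambda$. Let $\mathbb P_{\mathcal S}$ be a probability measure on $\mathcal S$ with a Lipschitz continuous Lebesgue density $\rho_{\mathcal S}$ such that $0<c\le\rho_{\mathcal S}\le C<\infty$ on $\mathcal S$ for some constants $c,C$. Let $\mathbb P_\Lambda=E_\#\mathbb P_{\mathcal S}$, a Borel probability measure on $(\Lambda,d_{W_2})$, and assume that every $\mu\in\operatorname{spt}(\mathbb P_\Lambda)$ has a Lipschitz continuous density $\rho_\mu$ on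 $\Omega$, with $0<c'\le\rho_\mu\le C'<\infty$ on $\Omega$ for constants $c',C'$ independent of $\mu$. For $1<p<\infty$ let $W^{1,p}(\mathcal S)$ be the space of functions in $L^p(\mathcal S)$ with a weak gradient in $L^p(\mathcal S)$, and let $W^{1,p}(\Lambda,d_{W_2},\mathbb P_\Lambda)$ be the space of functions $f:\Lambda\to\mathbb R$ in $L^p(\mathbb P_\Lambda)$ for which there are a set $\Lambda'\subset\Lambda$ with $\mathbb P_\Lambda(\Lambda')=0$ and a function $0\le g\in L^p(\mathbb P_\Lambda)$ with $$|f(\mu)-f(\nu)|\le d_{W_2}(\mu,\nu)\,\big(g(\mu)+g(\nu)\big)\qquad\text{for all }\mu,\nu\in\Lambda\setminus\Lambda'.$$ Then, for every $1<p<\infty$, $$W^{1,p}(\Lambda,d_{W_2},\mathbb P_\Lambda)=\big\{f:\Lambda\to\mathbb R \;:\; f\circ E\in W^{1,p}(\mathcal S)\big\}.$$ -/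

import Mathlib

open MeasureTheory

noncomputable section

/-- `π` is a transport plan (coupling) between `μ` and `ν`: its first marginal is `μ` and its
second marginal is `ν`. -/
def IsCoupling {X : Type*} [MeasurableSpace X] (μ ν : Measure X) (π : Measure (X × X)) : Prop :=
  π.map Prod.fst = μ ∧ π.map Prod.snd = ν

/-- The `2`-Wasserstein distance, the infimum of `(∫ |x - y| ^ 2 dπ) ^ (1/2)` over all
transport plans `π` (with values in `[0, ∞]`). -/
def wassersteinTwo {X : Type*} [PseudoEMetricSpace X] [MeasurableSpace X] (μ ν : Measure X) :
    ENNReal :=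
  ⨅ (π : Measure (X × X)) (_ : IsCoupling μ ν π),
    (∫⁻ z, edist z.1 z.2 ^ (2 : ℝ) ∂π) ^ (1 / 2 : ℝ)

theorem wassersteinTwo_self {X : Type*} [PseudoEMetricSpace X] [MeasurableSpace X]
    [OpensMeasurableSpace X] [SecondCountableTopology X] (μ : Measure X) :
    wassersteinTwo μ μ = 0 := by
  have hm : Measurable (fun x : X => (x, x)) := measurable_id.prodMk measurable_id
  refine le_antisymm (iInf₂_le_of_le (μ.map fun x => (x, x)) ⟨?_, ?_⟩ ?_) bot_le
  · rw [Measure.map_map measurable_fst hm]; exact Measure.map_id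
  · rw [Measure.map_map measurable_snd hm]; exact Measure.map_id
  · rw [lintegral_map (by fun_prop) hm]
    simp

theorem wassersteinTwo_comm_le {X : Type*} [PseudoEMetricSpace X] [MeasurableSpace X]
    [OpensMeasurableSpace X] [SecondCountableTopology X] (μ ν : Measure X) :
    wassersteinTwo μ ν ≤ wassersteinTwo ν μ := by
  refine le_iInf₂ fun π hπ => iInf₂_le_of_le (π.map Prod.swap) ⟨?_, ?_⟩ ?_
  · rw [Measure.map_map measurable_fst measurable_swap]; exact hπ.2
  · rw [Measure.map_map measurable_snd measurable_swap]; exact hπ.1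
  · rw [lintegral_map (by fun_prop) measurable_swap]
    simp [edist_comm]

/-- Gluing of two transport plans along their common marginal. -/
theorem exists_gluing {X : Type*} [MeasurableSpace X] [StandardBorelSpace X] [Nonempty X]
    {μ ν ξ : Measure X} [IsProbabilityMeasure ν] {π₁ π₂ : Measure (X × X)}
    (h₁ : IsCoupling μ ν π₁) (h₂ : IsCoupling ν ξ π₂) :
    ∃ γ : Measure (X × X × X), γ.map (fun w => (w.2.1, w.1)) = π₁ ∧
      γ.map (fun w => (w.1, w.2.2)) = π₂ := by
  have hp₂ : IsProbabilityMeasure π₂ := by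
    have : IsProbabilityMeasure (π₂.map Prod.fst) := by rw [h₂.1]; infer_instance
    exact (Measure.isProbabilityMeasure_map_iff measurable_fst.aemeasurable).1 this
  have hp₁ : IsProbabilityMeasure π₁ := by
    have : IsProbabilityMeasure (π₁.map Prod.snd) := by rw [h₁.2]; infer_instance
    exact (Measure.isProbabilityMeasure_map_iff measurable_snd.aemeasurable).1 this
  have hp₃ : IsProbabilityMeasure (π₁.map Prod.swap) :=
    Measure.isProbabilityMeasure_map measurable_swap.aemeasurable
  have hf₃ : (π₁.map Prod.swap).fst = ν := by
    rw [Measure.fst, Measure.map_map measurable_fst measurable_swap]; exact h₁.2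
  have hf₂ : π₂.fst = ν := h₂.1
  have e₃ : ν.compProd (π₁.map Prod.swap).condKernel = π₁.map Prod.swap := by
    conv_lhs => rw [← hf₃]
    exact Measure.disintegrate _ _
  have e₂ : ν.compProd π₂.condKernel = π₂ := by
    conv_lhs => rw [← hf₂]
    exact Measure.disintegrate _ _
  refine ⟨ν.compProd (ProbabilityTheory.Kernel.prod (π₁.map Prod.swap).condKernel π₂.condKernel),
    ?_, ?_⟩
  · have : (fun w : X × X × X => (w.2.1, w.1)) = Prod.swap ∘ Prod.map id Prod.fst := rfl
    rw [this, ← Measure.map_map measurable_swap (by fun_prop),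
      ← Measure.compProd_map measurable_fst, ← ProbabilityTheory.Kernel.fst_eq,
      ProbabilityTheory.Kernel.fst_prod, e₃, Measure.map_map measurable_swap measurable_swap,
      Prod.swap_swap_eq, Measure.map_id]
  · have : (fun w : X × X × X => (w.1, w.2.2)) = Prod.map id Prod.snd := rfl
    rw [this, ← Measure.compProd_map measurable_snd, ← ProbabilityTheory.Kernel.snd_eq,
      ProbabilityTheory.Kernel.snd_prod, e₂]

theorem wassersteinTwo_triangle {X : Type*} [PseudoEMetricSpace X] [MeasurableSpace X]
    [OpensMeasurableSpace X] [SecondCountableTopology X] [StandardBorelSpace X] [Nonempty X]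
    (μ ν ξ : Measure X) [IsProbabilityMeasure ν] :
    wassersteinTwo μ ξ ≤ wassersteinTwo μ ν + wassersteinTwo ν ξ := by
  unfold wassersteinTwo
  simp only [ENNReal.iInf_add, ENNReal.add_iInf]
  refine le_iInf₂ fun π₂ h₂ => le_iInf₂ fun π₁ h₁ => ?_
  obtain ⟨γ, g₁, g₂⟩ := exists_gluing h₁ h₂
  refine iInf₂_le_of_le (γ.map fun w => (w.2.1, w.2.2)) ⟨?_, ?_⟩ ?_
  · rw [Measure.map_map measurable_fst (by fun_prop), ← h₁.1, ← g₁,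
      Measure.map_map measurable_fst (by fun_prop)]
    rfl
  · rw [Measure.map_map measurable_snd (by fun_prop), ← h₂.2, ← g₂,
      Measure.map_map measurable_snd (by fun_prop)]
    rfl
  · rw [← g₁, ← g₂, lintegral_map (by fun_prop) (by fun_prop),
      lintegral_map (by fun_prop) (by fun_prop), lintegral_map (by fun_prop) (by fun_prop)]
    refine le_trans ?_ (ENNReal.lintegral_Lp_add_le (p := 2) (by fun_prop) (by fun_prop)
      (by norm_num))
    gcongr
    exact edist_triangle _ _ _

/-- The space of Borel probability measures on `Ω ⊆ ℝᵏ` (regarded as measures on `ℝᵏ`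
concentrated on `Ω`) that are absolutely continuous with respect to the Lebesgue measure. -/
structure AcProb {k : ℕ} (Ω : Set (EuclideanSpace ℝ (Fin k))) where
  /-- the underlying measure -/
  toMeasure : Measure (EuclideanSpace ℝ (Fin k))
  isProbabilityMeasure : IsProbabilityMeasure toMeasure
  absolutelyContinuous : toMeasure ≪ volume
  measure_compl : toMeasure Ωᶜ = 0

/-- The absolutely continuous probability measures with the `2`-Wasserstein distance. -/
instance {k : ℕ} (Ω : Set (EuclideanSpace ℝ (Fin k))) : PseudoEMetricSpace (AcProb Ω) where
  edist μ ν := wassersteinTwo μ.toMeasure ν.toMeasure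
  edist_self μ := wassersteinTwo_self μ.toMeasure
  edist_comm μ ν := le_antisymm (wassersteinTwo_comm_le _ _) (wassersteinTwo_comm_le _ _)
  edist_triangle μ ν ξ := by
    have := ν.isProbabilityMeasure
    exact wassersteinTwo_triangle _ _ _

/-- The Borel `σ`-algebra of the `2`-Wasserstein distance. -/
instance {k : ℕ} (Ω : Set (EuclideanSpace ℝ (Fin k))) : MeasurableSpace (AcProb Ω) :=
  borel (AcProb Ω)

instance {k : ℕ} (Ω : Set (EuclideanSpace ℝ (Fin k))) : BorelSpace (AcProb Ω) := ⟨rfl⟩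

/-- The boundary of `U ⊆ ℝⁿ` is smooth: near each boundary point, `U` is the region strictly
above the graph, in the direction of some unit vector `e`, of a smooth function of the component
orthogonal to `e`. -/
def HasSmoothBoundary {n : ℕ} (U : Set (EuclideanSpace ℝ (Fin n))) : Prop :=
  ∀ x ∈ frontier U, ∃ r : ℝ, 0 < r ∧ ∃ (e : EuclideanSpace ℝ (Fin n))
    (γ : EuclideanSpace ℝ (Fin n) → ℝ), ‖e‖ = 1 ∧ ContDiff ℝ (⊤ : ℕ∞) γ ∧
      ∀ y ∈ Metric.ball x r, y ∈ U ↔ γ (y - inner ℝ e y • e) < inner ℝ e y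

/-- An open, connected (in particular nonempty), bounded subset of `ℝⁿ` with smooth boundary. -/
structure IsSmoothBoundedDomain {n : ℕ} (U : Set (EuclideanSpace ℝ (Fin n))) : Prop where
  isOpen : IsOpen U
  isConnected : IsConnected U
  isBounded : Bornology.IsBounded U
  hasSmoothBoundary : HasSmoothBoundary U

/-- The Lebesgue measure on a measurable set `S ⊆ ℝᵈ`. -/
def lebesgueOn {d : ℕ} (S : Set (EuclideanSpace ℝ (Fin d))) : Measure S :=
  (volume : Measure (EuclideanSpace ℝ (Fin d))).comap Subtype.val

/-- `g` is the weak gradient of `u` on the open set `S ⊆ ℝᵈ`: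
`∫_S u ∂ᵢφ = - ∫_S gᵢ φ` for all `φ ∈ C_c^∞(S)` and all `i`. -/
def IsWeakGradient {d : ℕ} {S : Set (EuclideanSpace ℝ (Fin d))} (u : S → ℝ)
    (g : S → EuclideanSpace ℝ (Fin d)) : Prop :=
  ∀ φ : EuclideanSpace ℝ (Fin d) → ℝ, ContDiff ℝ (⊤ : ℕ∞) φ → HasCompactSupport φ →
    tsupport φ ⊆ S → ∀ i : Fin d,
      ∫ x : S, u x * fderiv ℝ φ x (EuclideanSpace.single i 1) ∂(lebesgueOn S) =
        - ∫ x : S, g x i * φ x ∂(lebesgueOn S)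

/-- The Sobolev space `W^{1,p}(S)`, as a set of functions on `S`. -/
def sobolevSpace {d : ℕ} (S : Set (EuclideanSpace ℝ (Fin d))) (p : ENNReal) : Set (S → ℝ) :=
  {u | MemLp u p (lebesgueOn S) ∧
    ∃ g : S → EuclideanSpace ℝ (Fin d), MemLp g p (lebesgueOn S) ∧ IsWeakGradient u g}

/-- The homogeneous metric Sobolev space `L^{1,p}(X, d, P)`: the `P`-measurable functions `f`
with `|f x - f y| ≤ d x y * (g x + g y)` outside a `P`-null set, for some nonnegative
`g ∈ L^p(P)`. -/
def hajlaszSeminormSpace (X : Type*) [PseudoEMetricSpace X] [MeasurableSpace X]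
    (P : Measure X) (p : ENNReal) : Set (X → ℝ) :=
  {f | AEMeasurable f P ∧ ∃ (N : Set X) (g : X → ℝ), P N = 0 ∧ (∀ x, 0 ≤ g x) ∧ MemLp g p P ∧
    ∀ x ∉ N, ∀ y ∉ N, |f x - f y| ≤ (edist x y).toReal * (g x + g y)}

/-- The metric Sobolev space `W^{1,p}(X, d, P) = L^p(P) ∩ L^{1,p}(X, d, P)`. -/
def hajlaszSobolevSpace (X : Type*) [PseudoEMetricSpace X] [MeasurableSpace X]
    (P : Measure X) (p : ENNReal) : Set (X → ℝ) :=
  {f | MemLp f p P} ∩ hajlaszSeminormSpace X P p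

/-- `P` has a Lipschitz continuous density on `S` with respect to the Lebesgue measure, bounded
and bounded away from zero. -/
def HasBoundedLipschitzDensity {d : ℕ} {S : Set (EuclideanSpace ℝ (Fin d))}
    (P : Measure S) : Prop :=
  ∃ (ρ : S → ℝ) (K : NNReal) (c C : ℝ), LipschitzWith K ρ ∧ 0 < c ∧
    (∀ θ, c ≤ ρ θ ∧ ρ θ ≤ C) ∧ P = (lebesgueOn S).withDensity fun θ => ENNReal.ofReal (ρ θ)

/-- All members of `M` have Lipschitz continuous densities on `Ω`, bounded and bounded away from
zero with constants `c`, `C` that are the same for all of them. -/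
def HasUniformlyBoundedLipschitzDensities {k : ℕ} {Ω : Set (EuclideanSpace ℝ (Fin k))}
    (M : Set (AcProb Ω)) : Prop :=
  ∃ c C : ℝ, 0 < c ∧ ∀ μ ∈ M, ∃ (ρ : EuclideanSpace ℝ (Fin k) → ℝ) (K : NNReal),
    LipschitzOnWith K ρ Ω ∧ (∀ x ∈ Ω, c ≤ ρ x ∧ ρ x ≤ C) ∧
      μ.toMeasure = (volume.restrict Ω).withDensity fun x => ENNReal.ofReal (ρ x)

end

noncomputable section

/-! ### The Hardy-Littlewood maximal theorem. -/

section Maximal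

open Metric ENNReal Set

variable {E : Type*} [NormedAddCommGroup E] [NormedSpace ℝ E] [FiniteDimensional ℝ E]
  [MeasurableSpace E] [BorelSpace E]

/-- The Hardy-Littlewood maximal function over balls with rational radius at most `R`. -/
def maximalFunction (μ : Measure E) (R : ℝ) (G : E → ℝ≥0∞) (x : E) : ℝ≥0∞ :=
  ⨆ (q : ℚ) (_ : 0 < (q : ℝ) ∧ (q : ℝ) ≤ R), (∫⁻ y in closedBall x q, G y ∂μ) / μ (closedBall x q)

/-- Rational radii make the supremum countable. Each ball integral is measurable in its centre by
Tonelli, and the denominator is the case of the constant function `1`. -/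
theorem measurable_maximalFunction (μ : Measure E) [SFinite μ] (R : ℝ) {G : E → ℝ≥0∞}
    (hG : Measurable G) : Measurable (maximalFunction μ R G) := by
  have key : ∀ (q : ℝ) {F : E → ℝ≥0∞}, Measurable F →
      Measurable fun x => ∫⁻ y in closedBall x q, F y ∂μ := by
    intro q F hF
    have hs : MeasurableSet {z : E × E | dist z.2 z.1 ≤ q} :=
      measurableSet_le (by fun_prop) measurable_const
    have h := Measurable.lintegral_prod_right' (ν := μ)
      ((hF.comp measurable_snd).indicator hs)
    convert h using 2 with x
    rw [← lintegral_indicator measurableSet_closedBall]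
    rfl
  refine Measurable.iSup fun q => Measurable.iSup fun _ => (key q hG).div ?_
  convert key q (measurable_const (a := (1 : ℝ≥0∞))) using 2 with x
  simp

/-- An arbitrary radius is enlarged to a rational one between `r` and `2 * r`; this is the source of
the doubled ball in all later bounds. -/
theorem lintegral_ball_le_maximalFunction (μ : Measure E) [μ.IsAddHaarMeasure] {R : ℝ}
    (G : E → ℝ≥0∞) (x : E) {r : ℝ} (hr : 0 < r) (hrR : 2 * r ≤ R) :
    ∫⁻ y in closedBall x r, G y ∂μ ≤ μ (closedBall x (2 * r)) * maximalFunction μ R G x := by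
  obtain ⟨q, hq1, hq2⟩ := exists_rat_btwn (show r < 2 * r by linarith)
  have hq0 : (0 : ℝ) < q := hr.trans hq1
  calc ∫⁻ y in closedBall x r, G y ∂μ ≤ ∫⁻ y in closedBall x q, G y ∂μ :=
        lintegral_mono_set (closedBall_subset_closedBall hq1.le)
    _ = μ (closedBall x q) * ((∫⁻ y in closedBall x q, G y ∂μ) / μ (closedBall x q)) := by
        rw [ENNReal.mul_div_cancel (measure_closedBall_pos μ x hq0).ne'
          measure_closedBall_lt_top.ne]
    _ ≤ _ := by
        gcongr
        exact le_iSup₂_of_le (f := fun (q : ℚ) (_ : 0 < (q : ℝ) ∧ (q : ℝ) ≤ R) =>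
          (∫⁻ y in closedBall x q, G y ∂μ) / μ (closedBall x q)) q ⟨hq0, by linarith⟩ le_rfl

/-- The weak type `(1, 1)` estimate for the maximal function. -/
theorem mul_measure_lt_maximalFunction_le (μ : Measure E) [μ.IsAddHaarMeasure] (R : ℝ)
    (G : E → ℝ≥0∞) (l : ℝ≥0∞) :
    l * μ {x | l < maximalFunction μ R G x} ≤
      ENNReal.ofReal (5 ^ Module.finrank ℝ E) * ∫⁻ y, G y ∂μ := by
  set t := {x | l < maximalFunction μ R G x}
  have h1 : ∀ x ∈ t, ∃ r : ℝ, (0 < r ∧ r ≤ R) ∧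
      l * μ (closedBall x r) ≤ ∫⁻ y in closedBall x r, G y ∂μ := by
    intro x hx
    obtain ⟨q, hq⟩ := lt_iSup_iff.1 (show l < maximalFunction μ R G x from hx)
    obtain ⟨hq', hlt⟩ := lt_iSup_iff.1 hq
    refine ⟨q, hq', ?_⟩
    exact (ENNReal.le_div_iff_mul_le (Or.inl (measure_closedBall_pos μ x hq'.1).ne')
      (Or.inl measure_closedBall_lt_top.ne)).1 hlt.le
  choose! r hr hle using h1
  -- The bound `R` on the radii is what makes the Vitali selection possible; the enlargement factor
  -- `5` becomes the constant `5 ^ dim`.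
  obtain ⟨u, hut, hdisj, hcov⟩ := Vitali.exists_disjoint_subfamily_covering_enlargement_closedBall
    t id r R (fun a ha => (hr a ha).2) 5 (by norm_num)
  have hu : u.Countable := hdisj.countable_of_nonempty_interior fun a ha =>
    (nonempty_ball.2 (hr a (hut ha)).1).mono ball_subset_interior_closedBall
  have ht : t ⊆ ⋃ b ∈ u, closedBall b (5 * r b) := by
    intro a ha
    obtain ⟨b, hb, hab⟩ := hcov a ha
    exact mem_biUnion hb (hab (mem_closedBall_self (hr a ha).1.le))
  calc l * μ t ≤ l * ∑' b : u, μ (closedBall (b : E) (5 * r b)) := by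
        gcongr
        exact (measure_mono ht).trans (measure_biUnion_le μ hu _)
    _ = ENNReal.ofReal (5 ^ Module.finrank ℝ E) * ∑' b : u, l * μ (closedBall (b : E) (r b)) := by
        rw [← ENNReal.tsum_mul_left, ← ENNReal.tsum_mul_left]
        refine tsum_congr fun b => ?_
        rw [Measure.addHaar_closedBall_mul μ _ (by norm_num) (hr b (hut b.2)).1.le,
          ← Measure.addHaar_closedBall_center μ (b : E) (r b), mul_left_comm]
    _ ≤ ENNReal.ofReal (5 ^ Module.finrank ℝ E) *
          ∑' b : u, ∫⁻ y in closedBall (b : E) (r b), G y ∂μ := by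
        gcongr with b
        exact hle b (hut b.2)
    _ = ENNReal.ofReal (5 ^ Module.finrank ℝ E) *
          ∫⁻ y in ⋃ b ∈ u, closedBall (b : E) (r b), G y ∂μ := by
        rw [lintegral_biUnion hu (fun _ _ => measurableSet_closedBall)
          (show u.PairwiseDisjoint fun b => closedBall b (r b) from hdisj)]
    _ ≤ _ := by
        gcongr
        exact Measure.restrict_le_self

/-- The weak type estimate involving only the large values of the function. -/
theorem mul_measure_lt_maximalFunction_le_setLIntegral (μ : Measure E) [μ.IsAddHaarMeasure] (R : ℝ)
    {G : E → ℝ≥0∞} (hG : Measurable G) (l : ℝ≥0∞) :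
    l * μ {x | l + l < maximalFunction μ R G x} ≤
      ENNReal.ofReal (5 ^ Module.finrank ℝ E) * ∫⁻ y in {y | l < G y}, G y ∂μ := by
  have hs : MeasurableSet {y | l < G y} := measurableSet_lt measurable_const hG
  rw [← lintegral_indicator hs]
  refine le_trans ?_ (mul_measure_lt_maximalFunction_le μ R _ l)
  -- Since `G` is at most its truncation above level `l` plus `l`, its averages exceed `l + l` only
  -- where those of the truncation exceed `l`.
  refine mul_le_mul_right (measure_mono fun x hx => ?_) l
  by_contra hcon
  simp only [mem_ofPred_eq, not_lt] at hx hcon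
  refine hx.not_ge (iSup₂_le fun q hq => ?_)
  have h2 : (∫⁻ y in closedBall x q, ({y | l < G y}.indicator G) y ∂μ) / μ (closedBall x q) ≤ l :=
    le_trans (le_iSup₂_of_le (f := fun (q : ℚ) (_ : 0 < (q : ℝ) ∧ (q : ℝ) ≤ R) =>
          (∫⁻ y in closedBall x q, ({y | l < G y}.indicator G) y ∂μ) / μ (closedBall x q))
          q hq le_rfl) hcon
  have h0 := (measure_closedBall_pos μ x hq.1).ne'
  have h1 : μ (closedBall x (q : ℝ)) ≠ ⊤ := measure_closedBall_lt_top.ne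
  rw [ENNReal.div_le_iff h0 h1] at h2 ⊢
  calc ∫⁻ y in closedBall x q, G y ∂μ
      ≤ ∫⁻ y in closedBall x q, (({y | l < G y}.indicator G) y + l) ∂μ := by
        refine lintegral_mono fun y => ?_
        by_cases hy : l < G y
        · simp [hy]
        · simpa [hy] using not_lt.1 hy
    _ = (∫⁻ y in closedBall x q, ({y | l < G y}.indicator G) y ∂μ) + l * μ (closedBall x q) := by
        rw [lintegral_add_right _ measurable_const]; simp
    _ ≤ _ := by rw [add_mul]; gcongr

end Maximal

/-- A sublinear-type weak estimate implies the strong type `(p, p)` estimate, `1 < p < ∞`. -/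
theorem lintegral_rpow_lt_top_of_weak_type {α : Type*} [MeasurableSpace α] {μ : Measure α}
    [SFinite μ] {m g : α → ℝ} (hm : Measurable m) (hm0 : ∀ x, 0 ≤ m x) (hg : Measurable g)
    (hg0 : ∀ x, 0 ≤ g x) {A : ENNReal} (hA : A ≠ ⊤)
    (hweak : ∀ l : ℝ, 0 < l → ENNReal.ofReal l * μ {x | l < m x} ≤
      A * ∫⁻ x in {x | l < 2 * g x}, ENNReal.ofReal (g x) ∂μ)
    {p : ℝ} (hp : 1 < p) (hgp : ∫⁻ x, ENNReal.ofReal (g x ^ p) ∂μ < ⊤) :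
    ∫⁻ x, ENNReal.ofReal (m x ^ p) ∂μ < ⊤ := by
  -- Layer cake, the weak estimate, then Tonelli: the integral of `l ^ (p - 2)` over `(0, 2 g)`
  -- converges because `p > 1` and is a multiple of `g ^ (p - 1)`, which the factor `g` completes to
  -- `g ^ p`.
  rw [lintegral_rpow_eq_lintegral_meas_lt_mul μ (Filter.Eventually.of_forall hm0) hm.aemeasurable
    (by linarith)]
  refine ENNReal.mul_lt_top ENNReal.ofReal_lt_top ?_
  have h1 : ∀ l ∈ Set.Ioi (0 : ℝ), μ {x | l < m x} * ENNReal.ofReal (l ^ (p - 1)) ≤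
      A * ∫⁻ x, ({z : α × ℝ | z.2 < 2 * g z.1}.indicator
        (fun z => ENNReal.ofReal (g z.1) * ENNReal.ofReal (z.2 ^ (p - 2)))) (x, l) ∂μ := by
    intro l hl
    have hl : 0 < l := hl
    have e1 : ENNReal.ofReal (l ^ (p - 1)) = ENNReal.ofReal l * ENNReal.ofReal (l ^ (p - 2)) := by
      rw [← ENNReal.ofReal_mul hl.le]
      congr 1
      rw [← Real.rpow_one_add' hl.le (by linarith)]
      ring_nf
    have hs : MeasurableSet {x | l < 2 * g x} := measurableSet_lt measurable_const (by fun_prop)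
    have e2 : ∫⁻ x, ({z : α × ℝ | z.2 < 2 * g z.1}.indicator
        (fun z => ENNReal.ofReal (g z.1) * ENNReal.ofReal (z.2 ^ (p - 2)))) (x, l) ∂μ =
        (∫⁻ x in {x | l < 2 * g x}, ENNReal.ofReal (g x) ∂μ) * ENNReal.ofReal (l ^ (p - 2)) := by
      rw [← lintegral_mul_const _ (by fun_prop), ← lintegral_indicator hs]
      rfl
    rw [e1, e2, ← mul_assoc, ← mul_assoc, mul_comm (μ _)]
    refine mul_le_mul_left ?_ _
    exact hweak l hl
  have hmeas : Measurable ({z : α × ℝ | z.2 < 2 * g z.1}.indicator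
      (fun z => ENNReal.ofReal (g z.1) * ENNReal.ofReal (z.2 ^ (p - 2)))) :=
    Measurable.indicator (by fun_prop) (measurableSet_lt (by fun_prop) (by fun_prop))
  have h2 : ∀ x, ∫⁻ l in Set.Ioi (0 : ℝ), ({z : α × ℝ | z.2 < 2 * g z.1}.indicator
        (fun z => ENNReal.ofReal (g z.1) * ENNReal.ofReal (z.2 ^ (p - 2)))) (x, l) =
      ENNReal.ofReal (2 ^ (p - 1) / (p - 1)) * ENNReal.ofReal (g x ^ p) := by
    intro x
    have hgx := hg0 x
    have e1 : ∀ l, ({z : α × ℝ | z.2 < 2 * g z.1}.indicator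
        (fun z => ENNReal.ofReal (g z.1) * ENNReal.ofReal (z.2 ^ (p - 2)))) (x, l) =
        (Set.Iio (2 * g x)).indicator
          (fun l => ENNReal.ofReal (g x) * ENNReal.ofReal (l ^ (p - 2))) l := fun l => rfl
    simp only [e1]
    rw [lintegral_indicator measurableSet_Iio, Measure.restrict_restrict measurableSet_Iio,
      Set.inter_comm, Set.Ioi_inter_Iio, lintegral_const_mul _ (by fun_prop),
      restrict_Ioo_eq_restrict_Ioc,
      ← ofReal_integral_eq_lintegral_ofReal, ← intervalIntegral.integral_of_le (by positivity),
      integral_rpow (Or.inl (by linarith)), ← ENNReal.ofReal_mul hgx,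
      ← ENNReal.ofReal_mul (div_nonneg (by positivity) (by linarith))]
    · congr 1
      have : g x ^ p = g x * g x ^ (p - 1) := by
        rw [← Real.rpow_one_add' hgx (by linarith)]
        ring_nf
      rw [show p - 2 + 1 = p - 1 by ring, Real.zero_rpow (by linarith), this,
        Real.mul_rpow (by norm_num) hgx]
      ring
    · exact (intervalIntegral.intervalIntegrable_rpow' (by linarith)).1
    · exact (ae_restrict_iff' measurableSet_Ioc).2
        (Filter.Eventually.of_forall fun l hl => Real.rpow_nonneg hl.1.le _)
  calc ∫⁻ l in Set.Ioi (0 : ℝ), μ {x | l < m x} * ENNReal.ofReal (l ^ (p - 1))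
      ≤ ∫⁻ l in Set.Ioi (0 : ℝ), A * ∫⁻ x, ({z : α × ℝ | z.2 < 2 * g z.1}.indicator
        (fun z => ENNReal.ofReal (g z.1) * ENNReal.ofReal (z.2 ^ (p - 2)))) (x, l) ∂μ :=
        setLIntegral_mono' measurableSet_Ioi h1
    _ = A * ∫⁻ x, (∫⁻ l in Set.Ioi (0 : ℝ), ({z : α × ℝ | z.2 < 2 * g z.1}.indicator
        (fun z => ENNReal.ofReal (g z.1) * ENNReal.ofReal (z.2 ^ (p - 2)))) (x, l)) ∂μ := by
        rw [lintegral_const_mul' _ _ hA, lintegral_lintegral_swap]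
        exact hmeas.comp measurable_swap |>.aemeasurable
    _ = A * (ENNReal.ofReal (2 ^ (p - 1) / (p - 1)) * ∫⁻ x, ENNReal.ofReal (g x ^ p) ∂μ) := by
        simp only [h2]
        rw [lintegral_const_mul' _ _ ENNReal.ofReal_ne_top]
    _ < ⊤ := ENNReal.mul_lt_top hA.lt_top (ENNReal.mul_lt_top ENNReal.ofReal_lt_top hgp)

/-- The Hardy-Littlewood maximal theorem in `L^p`, `1 < p < ∞`. -/
theorem exists_memLp_forall_integral_ball_le {E : Type*} [NormedAddCommGroup E] [NormedSpace ℝ E]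
    [FiniteDimensional ℝ E] [MeasurableSpace E] [BorelSpace E] (μ : Measure E) [μ.IsAddHaarMeasure]
    {p : ENNReal} (hp : 1 < p) (hp_top : p ≠ ⊤) {g : E → ℝ} (hg0 : ∀ x, 0 ≤ g x)
    (hgi : Integrable g μ) (hgp : MemLp g p μ) (R : ℝ) :
    ∃ m : E → ℝ, (∀ x, 0 ≤ m x) ∧ MemLp m p μ ∧ ∀ᵐ x ∂μ, ∀ r, 0 < r → 2 * r ≤ R →
      ∫ y in Metric.closedBall x r, g y ∂μ ≤ μ.real (Metric.closedBall x (2 * r)) * m x := by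
  have hp1 : 1 < p.toReal := by
    rw [← ENNReal.toReal_one]
    exact (ENNReal.toReal_lt_toReal ENNReal.one_ne_top hp_top).2 hp
  have hp0 : p ≠ 0 := (zero_lt_one.trans hp).ne'
  obtain ⟨h, hh, hh0, hgh⟩ := hgi.aemeasurable.exists_measurable_nonneg
    (Filter.Eventually.of_forall hg0)
  set M := maximalFunction μ R fun x => ENNReal.ofReal (h x)
  have hhm : Measurable fun x => ENNReal.ofReal (h x) := by fun_prop
  have hMm : Measurable M := measurable_maximalFunction μ R hhm
  have hfin : ∫⁻ y, ENNReal.ofReal (h y) ∂μ < ⊤ := (hgi.congr hgh).lintegral_lt_top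
  -- The real-valued majorant is `(M x).toReal`, which is `0` where `M` is infinite, so such points
  -- must form a null set; the weak estimate at every integer level shows this.
  have hMtop : ∀ᵐ x ∂μ, M x < ⊤ := by
    have hle : ∀ n : ℕ, (n : ENNReal) * μ {x | M x = ⊤} ≤
        ENNReal.ofReal (5 ^ Module.finrank ℝ E) * ∫⁻ y, ENNReal.ofReal (h y) ∂μ := fun n =>
      (mul_le_mul_right (measure_mono fun x (hx : M x = ⊤) =>
        show (n : ENNReal) < M x from hx ▸ ENNReal.natCast_lt_top n) _).trans
        (mul_measure_lt_maximalFunction_le μ R _ n)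
    have hzero : μ {x | M x = ⊤} = 0 := by
      by_contra hne
      have hC : ENNReal.ofReal (5 ^ Module.finrank ℝ E) * ∫⁻ y, ENNReal.ofReal (h y) ∂μ < ⊤ :=
        ENNReal.mul_lt_top ENNReal.ofReal_lt_top hfin
      obtain ⟨n, hn⟩ := ENNReal.exists_nat_mul_gt hne hC.ne
      exact (hle n).not_gt hn
    rw [ae_iff]
    simpa using hzero
  refine ⟨fun x => (M x).toReal, fun x => ENNReal.toReal_nonneg, ?_, ?_⟩
  · refine ⟨hMm.ennreal_toReal.aestronglyMeasurable, ?_⟩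
    rw [eLpNorm_lt_top_iff_lintegral_rpow_enorm_lt_top hp0 hp_top]
    have hhp := (memLp_congr_ae hgh).1 hgp
    have hconv : ∀ {f : E → ℝ}, (∀ x, 0 ≤ f x) → ∫⁻ x, ENNReal.ofReal (f x ^ p.toReal) ∂μ =
        ∫⁻ x, ‖f x‖ₑ ^ p.toReal ∂μ := fun hf => lintegral_congr fun x => by
      rw [Real.enorm_of_nonneg (hf x), ENNReal.ofReal_rpow_of_nonneg (hf x) (by linarith)]
    rw [← hconv fun x => ENNReal.toReal_nonneg]
    refine lintegral_rpow_lt_top_of_weak_type hMm.ennreal_toReal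
      (fun x => ENNReal.toReal_nonneg) hh hh0
      (A := 2 * ENNReal.ofReal (5 ^ Module.finrank ℝ E))
      (ENNReal.mul_ne_top (by simp) ENNReal.ofReal_ne_top) (fun l hl => ?_) hp1 ?_
    -- Level `l` is split as `l / 2 + l / 2`; the resulting loss is the factor `2` in `A`.
    · have hw := mul_measure_lt_maximalFunction_le_setLIntegral μ R hhm (ENNReal.ofReal (l / 2))
      rw [← ENNReal.ofReal_add (by positivity) (by positivity), add_halves] at hw
      have e1 : {x | ENNReal.ofReal (l / 2) < ENNReal.ofReal (h x)} = {x | l < 2 * h x} := by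
        ext x
        simp only [Set.mem_ofPred_eq]
        rw [ENNReal.ofReal_lt_ofReal_iff_of_nonneg (by positivity)]
        constructor <;> intro <;> linarith
      have e2 : ENNReal.ofReal l = 2 * ENNReal.ofReal (l / 2) := by
        rw [two_mul, ← ENNReal.ofReal_add (by positivity) (by positivity), add_halves]
      rw [e1] at hw
      rw [e2, mul_assoc, mul_assoc]
      refine mul_le_mul_right ((mul_le_mul_right (measure_mono fun x hx => ?_) _).trans hw) _
      exact (ENNReal.ofReal_lt_iff_lt_toReal hl.le
        (fun htop : M x = ⊤ => by simp [htop, hl.not_gt] at hx)).2 hx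
    · rw [hconv hh0, ← eLpNorm_lt_top_iff_lintegral_rpow_enorm_lt_top hp0 hp_top]
      exact hhp.2
  · filter_upwards [hMtop] with x hx r hr hrR
    have hle := lintegral_ball_le_maximalFunction μ (fun x => ENNReal.ofReal (h x)) x hr hrR
    rw [integral_congr_ae (ae_restrict_of_ae hgh),
      integral_eq_lintegral_of_nonneg_ae (Filter.Eventually.of_forall hh0)
        hh.aestronglyMeasurable, measureReal_def, ← ENNReal.toReal_mul]
    exact ENNReal.toReal_mono (ENNReal.mul_ne_top measure_closedBall_lt_top.ne hx.ne) hle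

/-! ### Averages along a cone of rescaled kernels. -/

section ConeAverages

open Metric Filter Topology

variable {d : ℕ}

/-- The pairing of a weakly differentiable function with the divergence of the rescaled field
`z ↦ κ z • z`. -/
theorem integral_mul_radial_divergence {S : Set (EuclideanSpace ℝ (Fin d))}
    {f : EuclideanSpace ℝ (Fin d) → ℝ} {G : EuclideanSpace ℝ (Fin d) → EuclideanSpace ℝ (Fin d)}
    (hf : Integrable f) (hG : Integrable G)
    (hw : ∀ φ : EuclideanSpace ℝ (Fin d) → ℝ, ContDiff ℝ (⊤ : ℕ∞) φ → HasCompactSupport φ →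
      tsupport φ ⊆ S → ∀ i : Fin d,
      ∫ x, f x * fderiv ℝ φ x (EuclideanSpace.single i 1) = - ∫ x, G x i * φ x)
    {κ : EuclideanSpace ℝ (Fin d) → ℝ} (hκ : ContDiff ℝ (⊤ : ℕ∞) κ) (hκc : HasCompactSupport κ)
    {x : EuclideanSpace ℝ (Fin d)} {s : ℝ} (hs : 0 < s)
    (hS : ∀ u ∈ tsupport κ, x + s • u ∈ S) :
    ∫ w, f w * (s⁻¹ * (d * κ (s⁻¹ • (w - x)) + fderiv ℝ κ (s⁻¹ • (w - x)) (s⁻¹ • (w - x)))) =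
      - ∫ w, inner ℝ (G w) (s⁻¹ • (w - x)) * κ (s⁻¹ • (w - x)) := by
  set z : EuclideanSpace ℝ (Fin d) → EuclideanSpace ℝ (Fin d) := fun w => s⁻¹ • (w - x) with hz
  have hzd : ∀ w, HasFDerivAt z (s⁻¹ • ContinuousLinearMap.id ℝ (EuclideanSpace ℝ (Fin d))) w :=
    fun w => ((hasFDerivAt_id w).sub_const x).const_smul s⁻¹
  have hzc : ContDiff ℝ (⊤ : ℕ∞) z := (contDiff_id.sub contDiff_const).const_smul _
  set θ : Fin d → EuclideanSpace ℝ (Fin d) → ℝ := fun i w => z w i * κ (z w) with hθ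
  have hcoord : ∀ i, ContDiff ℝ (⊤ : ℕ∞) fun w => z w i := fun i =>
    (EuclideanSpace.proj (𝕜 := ℝ) i).contDiff.comp hzc
  have hθc : ∀ i, ContDiff ℝ (⊤ : ℕ∞) (θ i) := fun i => (hcoord i).mul (hκ.comp hzc)
  let e : EuclideanSpace ℝ (Fin d) ≃ₜ EuclideanSpace ℝ (Fin d) :=
    (Homeomorph.subRight x).trans (Homeomorph.smulOfNeZero s⁻¹ (inv_ne_zero hs.ne'))
  have hκz : HasCompactSupport fun w => κ (z w) := hκc.comp_homeomorph e
  have hθs : ∀ i, HasCompactSupport (θ i) := fun i => hκz.mul_left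
  have htsupp : ∀ i, tsupport (θ i) ⊆ S := by
    intro i w hw'
    have h1 : w ∈ tsupport (fun w => κ (z w)) := tsupport_mul_subset_right hw'
    have h2 : z w ∈ tsupport κ := tsupport_comp_subset_preimage κ hzc.continuous h1
    have := hS _ h2
    rwa [hz, smul_smul, mul_inv_cancel₀ hs.ne', one_smul, add_sub_cancel] at this
  have hder : ∀ i w, fderiv ℝ (θ i) w (EuclideanSpace.single i 1) =
      s⁻¹ * (κ (z w) + z w i * fderiv ℝ κ (z w) (EuclideanSpace.single i 1)) := by
    intro i w
    have h1 : HasFDerivAt (fun w => z w i) ((EuclideanSpace.proj (𝕜 := ℝ) i).comp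
      (s⁻¹ • ContinuousLinearMap.id ℝ (EuclideanSpace ℝ (Fin d)))) w :=
      (EuclideanSpace.proj (𝕜 := ℝ) i).hasFDerivAt.comp w (hzd w)
    have h2 : HasFDerivAt (fun w => κ (z w)) ((fderiv ℝ κ (z w)).comp
      (s⁻¹ • ContinuousLinearMap.id ℝ (EuclideanSpace ℝ (Fin d)))) w :=
      ((hκ.differentiable (by simp)) (z w)).hasFDerivAt.comp w (hzd w)
    have h3 : HasFDerivAt (θ i) _ w := h1.mul h2
    rw [h3.fderiv]
    simp
    ring
  have hint1 : ∀ i, Integrable fun w => f w * fderiv ℝ (θ i) w (EuclideanSpace.single i 1) := by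
    intro i
    have hc : Continuous fun w => fderiv ℝ (θ i) w (EuclideanSpace.single i 1) :=
      ((hθc i).continuous_fderiv (by simp)).clm_apply continuous_const
    obtain ⟨C, hC⟩ := (((hθs i).fderiv_apply ℝ (EuclideanSpace.single i 1))
      ).exists_bound_of_continuous hc
    exact hf.mul_bdd hc.aestronglyMeasurable (Eventually.of_forall hC)
  have hint2 : ∀ i, Integrable fun w => G w i * θ i w := by
    intro i
    obtain ⟨C, hC⟩ := (hθs i).exists_bound_of_continuous (hθc i).continuous
    exact ((EuclideanSpace.proj (𝕜 := ℝ) i).integrable_comp hG).mul_bdd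
      (hθc i).continuous.aestronglyMeasurable (Eventually.of_forall hC)
  have e1 : ∀ w, f w * (s⁻¹ * (d * κ (z w) + fderiv ℝ κ (z w) (z w))) =
      ∑ i, f w * fderiv ℝ (θ i) w (EuclideanSpace.single i 1) := by
    intro w
    have hsum : fderiv ℝ κ (z w) (z w) =
        ∑ i, z w i * fderiv ℝ κ (z w) (EuclideanSpace.single i 1) := by
      have := congrArg (fderiv ℝ κ (z w)) ((EuclideanSpace.basisFun (Fin d) ℝ).sum_repr (z w))
      rw [map_sum] at this
      simpa using this.symm
    simp_rw [hder]
    rw [← Finset.mul_sum, ← Finset.mul_sum, Finset.sum_add_distrib, hsum]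
    simp
  have e2 : ∀ w, inner ℝ (G w) (z w) * κ (z w) = ∑ i, G w i * θ i w := by
    intro w
    rw [PiLp.inner_apply, Finset.sum_mul]
    refine Finset.sum_congr rfl fun i _ => ?_
    simp only [hθ, RCLike.inner_apply, conj_trivial]
    ring
  change ∫ w, f w * (s⁻¹ * (d * κ (z w) + fderiv ℝ κ (z w) (z w))) =
    - ∫ w, inner ℝ (G w) (z w) * κ (z w)
  simp only [e1, e2]
  rw [integral_finsetSum _ fun i _ => hint1 i, integral_finsetSum _ fun i _ => hint2 i,
    ← Finset.sum_neg_distrib]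
  exact Finset.sum_congr rfl fun i _ => hw _ (hθc i) (hθs i) (htsupp i) i

/-- The derivative of the weighted averages of `f` along a shrinking family of kernels. -/
theorem hasDerivAt_integral_rescaled_kernel {S : Set (EuclideanSpace ℝ (Fin d))}
    {f : EuclideanSpace ℝ (Fin d) → ℝ} {G : EuclideanSpace ℝ (Fin d) → EuclideanSpace ℝ (Fin d)}
    (hf : Integrable f) (hG : Integrable G)
    (hw : ∀ φ : EuclideanSpace ℝ (Fin d) → ℝ, ContDiff ℝ (⊤ : ℕ∞) φ → HasCompactSupport φ →
      tsupport φ ⊆ S → ∀ i : Fin d,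
      ∫ x, f x * fderiv ℝ φ x (EuclideanSpace.single i 1) = - ∫ x, G x i * φ x)
    {κ : EuclideanSpace ℝ (Fin d) → ℝ} (hκ : ContDiff ℝ (⊤ : ℕ∞) κ) (hκc : HasCompactSupport κ)
    {x : EuclideanSpace ℝ (Fin d)} {s : ℝ} (hs : 0 < s)
    (hS : ∀ u ∈ tsupport κ, x + s • u ∈ S) :
    HasDerivAt (fun t : ℝ => ∫ w, f w * ((t ^ d)⁻¹ * κ (t⁻¹ • (w - x))))
      ((s ^ d)⁻¹ * ∫ w, inner ℝ (G w) (s⁻¹ • (w - x)) * κ (s⁻¹ • (w - x))) s := by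
  -- The `t`-derivative of `t⁻ᵈ κ((w - x) / t)` is `-t⁻ᵈ⁻¹ D((w - x) / t)`, a divergence, so the
  -- weak gradient can be brought in.
  set D : EuclideanSpace ℝ (Fin d) → ℝ := fun u => d * κ u + fderiv ℝ κ u u with hD
  have hDc : Continuous D := (continuous_const.mul hκ.continuous).add
    ((hκ.continuous_fderiv (by simp)).clm_apply continuous_id)
  have hDs : HasCompactSupport D := by
    refine hκc.mul_left.add ?_
    refine hκc.mono' fun u hu => ?_
    by_contra hcon
    exact hu (by simp [fderiv_of_notMem_tsupport ℝ hcon])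
  obtain ⟨C, hC⟩ := hDs.exists_bound_of_continuous hDc
  obtain ⟨C', hC'⟩ := hκc.exists_bound_of_continuous hκ.continuous
  have hdiff : ∀ w, ∀ t ∈ ball s (s / 2), HasDerivAt
      (fun t : ℝ => f w * ((t ^ d)⁻¹ * κ (t⁻¹ • (w - x))))
      (-(f w * ((t ^ d)⁻¹ * (t⁻¹ * D (t⁻¹ • (w - x)))))) t := by
    intro w t ht
    have ht0 : t ≠ 0 := by
      rw [Real.ball_eq_Ioo] at ht
      have := ht.1
      intro h
      linarith
    have h1 : HasDerivAt (fun t : ℝ => t⁻¹ • (w - x)) ((-(t ^ 2)⁻¹) • (w - x)) t :=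
      (hasDerivAt_inv ht0).smul_const _
    have h2 : HasDerivAt (fun t : ℝ => κ (t⁻¹ • (w - x)))
        (fderiv ℝ κ (t⁻¹ • (w - x)) ((-(t ^ 2)⁻¹) • (w - x))) t :=
      ((hκ.differentiable (by simp)) _).hasFDerivAt.comp_hasDerivAt t h1
    have h3 : HasDerivAt (fun t : ℝ => (t ^ d)⁻¹) (-(d * t ^ (d - 1)) / (t ^ d) ^ 2) t :=
      (hasDerivAt_pow d t).fun_inv (pow_ne_zero _ ht0)
    refine ((h3.mul h2).const_mul (f w)).congr_deriv ?_
    -- Natural subtraction truncates at `d = 0`, where the factor `d` rescues the identity.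
    have h4 : (d : ℝ) * t ^ (d - 1) = d * (t ^ d * t⁻¹) := by
      rcases Nat.eq_zero_or_pos d with h | h
      · simp [h]
      · rw [← pow_sub_one_mul h.ne' t]
        field_simp
    rw [h4]
    simp only [hD, map_smul, smul_eq_mul]
    field_simp
    ring
  have hpos : ∀ t ∈ ball s (s / 2), s / 2 < t := by
    intro t ht
    rw [Real.ball_eq_Ioo] at ht
    linarith [ht.1]
  have hkey := hasDerivAt_integral_of_dominated_loc_of_deriv_le (μ := volume)
    (F := fun (t : ℝ) w => f w * ((t ^ d)⁻¹ * κ (t⁻¹ • (w - x))))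
    (F' := fun (t : ℝ) w => -(f w * ((t ^ d)⁻¹ * (t⁻¹ * D (t⁻¹ • (w - x))))))
    (bound := fun w => ‖f w‖ * (((s / 2) ^ d)⁻¹ * ((s / 2)⁻¹ * C)))
    (x₀ := s) (s := ball s (s / 2)) (ball_mem_nhds s (by positivity))
    (Eventually.of_forall fun t => hf.aestronglyMeasurable.mul
      (by
        have := hκ.continuous
        exact Continuous.aestronglyMeasurable (by fun_prop)))
    (hf.mul_bdd (c := (s ^ d)⁻¹ * C')
      (by
        have := hκ.continuous
        exact Continuous.aestronglyMeasurable (by fun_prop))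
      (Eventually.of_forall fun w => by
        rw [norm_mul, Real.norm_of_nonneg (by positivity)]
        gcongr
        exact hC' _))
    (hf.aestronglyMeasurable.mul
      (Continuous.aestronglyMeasurable (by fun_prop))).neg
    (Eventually.of_forall fun w t ht => by
      have h1 := hpos t ht
      have h2 : 0 < t := by linarith
      rw [norm_neg, norm_mul, norm_mul, norm_mul, Real.norm_of_nonneg (show 0 ≤ (t ^ d)⁻¹ by positivity),
        Real.norm_of_nonneg (show 0 ≤ t⁻¹ by positivity)]
      gcongr
      exact hC _)
    (hf.norm.mul_const _)
    (Eventually.of_forall hdiff)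
  refine hkey.2.congr_deriv ?_
  have := integral_mul_radial_divergence hf hG hw hκ hκc hs hS
  rw [integral_neg, ← neg_eq_iff_eq_neg.2 this, mul_neg, ← integral_const_mul]
  congr 2
  ext w
  ring

/-- A weakly differentiable function differs from its average against a kernel, at the vertex of
a cone of rescaled kernels inside the domain, by at most the maximal function of its gradient. -/
theorem abs_sub_integral_kernel_le {S : Set (EuclideanSpace ℝ (Fin d))}
    {f : EuclideanSpace ℝ (Fin d) → ℝ} {G : EuclideanSpace ℝ (Fin d) → EuclideanSpace ℝ (Fin d)}
    (hf : Integrable f) (hG : Integrable G)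
    (hw : ∀ φ : EuclideanSpace ℝ (Fin d) → ℝ, ContDiff ℝ (⊤ : ℕ∞) φ → HasCompactSupport φ →
      tsupport φ ⊆ S → ∀ i : Fin d,
      ∫ x, f x * fderiv ℝ φ x (EuclideanSpace.single i 1) = - ∫ x, G x i * φ x)
    {κ : EuclideanSpace ℝ (Fin d) → ℝ} (hκ : ContDiff ℝ (⊤ : ℕ∞) κ) (hκ0 : ∀ u, 0 ≤ κ u)
    {B : ℝ} (hκB : ∀ u, κ u ≤ B) (hκ1 : ∫ u, κ u = 1) {r₀ : ℝ} (hr₀ : 0 < r₀)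
    (hsupp : tsupport κ ⊆ closedBall 0 r₀) {x : EuclideanSpace ℝ (Fin d)}
    (hleb : Tendsto (fun r => ⨍ y in closedBall x r, ‖f y - f x‖) (𝓝[>] 0) (𝓝 0))
    (hS : ∀ s : ℝ, 0 < s → s ≤ 1 → ∀ u ∈ tsupport κ, x + s • u ∈ S) {m : ℝ}
    (hm : ∀ r, 0 < r → r ≤ r₀ →
      ∫ y in closedBall x r, ‖G y‖ ≤ volume.real (closedBall x (2 * r)) * m) :
    |f x - ∫ w, f w * κ (w - x)| ≤
      r₀ * B * (2 * r₀) ^ d * volume.real (ball (0 : EuclideanSpace ℝ (Fin d)) 1) * m := by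
  set ω := volume.real (ball (0 : EuclideanSpace ℝ (Fin d)) 1)
  have hκc : HasCompactSupport κ := HasCompactSupport.of_support_subset_isCompact
    (isCompact_closedBall 0 r₀) ((subset_tsupport κ).trans hsupp)
  have hB0 : 0 ≤ B := (hκ0 0).trans (hκB 0)
  have hvol : ∀ r : ℝ, 0 ≤ r → volume.real (closedBall x r) = r ^ d * ω := fun r hr => by
    rw [Measure.addHaar_real_closedBall _ _ hr, finrank_euclideanSpace_fin]
  have hκout : ∀ u, u ∉ closedBall (0 : EuclideanSpace ℝ (Fin d)) r₀ → κ u = 0 := fun u hu =>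
    image_eq_zero_of_notMem_tsupport fun h => hu (hsupp h)
  have hzmem : ∀ {s : ℝ}, 0 < s → ∀ w, s⁻¹ • (w - x) ∈
      closedBall (0 : EuclideanSpace ℝ (Fin d)) r₀ ↔ w ∈ closedBall x (s * r₀) := by
    intro s hs w
    rw [mem_closedBall_zero_iff, norm_smul, Real.norm_of_nonneg (by positivity),
      mem_closedBall_iff_norm, inv_mul_le_iff₀ hs]
  set F : ℝ → ℝ := fun t => ∫ w, f w * ((t ^ d)⁻¹ * κ (t⁻¹ • (w - x))) with hF
  have hder : ∀ s ∈ Set.Ioc (0 : ℝ) 1, HasDerivWithinAt F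
      ((s ^ d)⁻¹ * ∫ w, inner ℝ (G w) (s⁻¹ • (w - x)) * κ (s⁻¹ • (w - x))) (Set.Ioc 0 1) s :=
    fun s hs => (hasDerivAt_integral_rescaled_kernel hf hG hw hκ hκc hs.1
      (hS s hs.1 hs.2)).hasDerivWithinAt
  -- The kernel lives on the ball of radius `s * r₀`, where the rescaled vector has norm at most
  -- `r₀`; the factor `s⁻ᵈ` cancels the volume of the doubled ball, leaving a bound free of `s`.
  have hbound : ∀ s ∈ Set.Ioc (0 : ℝ) 1,
      ‖(s ^ d)⁻¹ * ∫ w, inner ℝ (G w) (s⁻¹ • (w - x)) * κ (s⁻¹ • (w - x))‖ ≤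
        r₀ * B * (2 * r₀) ^ d * ω * m := by
    intro s hs
    have hs0 : 0 < s := hs.1
    have h1 : ‖∫ w, inner ℝ (G w) (s⁻¹ • (w - x)) * κ (s⁻¹ • (w - x))‖ ≤
        ∫ w, (closedBall x (s * r₀)).indicator (fun w => r₀ * B * ‖G w‖) w := by
      refine norm_integral_le_of_norm_le
        ((hG.norm.const_mul _).indicator measurableSet_closedBall) (Eventually.of_forall fun w => ?_)
      by_cases hwm : w ∈ closedBall x (s * r₀)
      · rw [Set.indicator_of_mem hwm, norm_mul, Real.norm_of_nonneg (hκ0 _)]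
        have h2 : ‖s⁻¹ • (w - x)‖ ≤ r₀ := mem_closedBall_zero_iff.1 ((hzmem hs0 w).2 hwm)
        calc ‖inner ℝ (G w) (s⁻¹ • (w - x))‖ * κ (s⁻¹ • (w - x)) ≤ (‖G w‖ * r₀) * B := by
              gcongr
              · exact hκ0 _
              · exact (norm_inner_le_norm _ _).trans (by gcongr)
              · exact hκB _
          _ = _ := by ring
      · rw [Set.indicator_of_notMem hwm, hκout _ fun h => hwm ((hzmem hs0 w).1 h)]
        simp
    rw [integral_indicator measurableSet_closedBall, integral_const_mul] at h1
    have h2 := hm (s * r₀) (by positivity) (mul_le_of_le_one_left hr₀.le hs.2)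
    rw [hvol _ (by positivity)] at h2
    rw [norm_mul, Real.norm_of_nonneg (by positivity)]
    calc (s ^ d)⁻¹ * ‖∫ w, inner ℝ (G w) (s⁻¹ • (w - x)) * κ (s⁻¹ • (w - x))‖
        ≤ (s ^ d)⁻¹ * (r₀ * B * ((2 * (s * r₀)) ^ d * ω * m)) := by
          gcongr
          exact h1.trans (by gcongr)
      _ = _ := by
          rw [show 2 * (s * r₀) = s * (2 * r₀) by ring, mul_pow s]
          field_simp
  have hmv : ∀ s ∈ Set.Ioc (0 : ℝ) 1, ‖F s - F 1‖ ≤ r₀ * B * (2 * r₀) ^ d * ω * m := by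
    intro s hs
    have h1 := (convex_Ioc (0 : ℝ) 1).norm_image_sub_le_of_norm_hasDerivWithin_le hder hbound
      (Set.right_mem_Ioc.2 one_pos) hs
    refine h1.trans (mul_le_of_le_one_right ((norm_nonneg _).trans (hbound s hs)) ?_)
    rw [Real.norm_eq_abs, abs_le]
    constructor <;> linarith [hs.1, hs.2]
  have hint : ∀ s : ℝ, 0 < s → ∫ w, (s ^ d)⁻¹ * κ (s⁻¹ • (w - x)) = 1 := by
    intro s hs
    rw [integral_const_mul, integral_sub_right_eq_self (fun w => κ (s⁻¹ • w)) x,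
      Measure.integral_comp_inv_smul_of_nonneg _ _ hs.le, hκ1, finrank_euclideanSpace_fin,
      smul_eq_mul, mul_one, inv_mul_cancel₀ (by positivity)]
  -- The rescaled kernel is at most `s⁻ᵈ B` on a ball of radius `s * r₀`, so its averages of `f - f
  -- x` are controlled by ball averages, which vanish in the limit at a Lebesgue point.
  have hlim : Tendsto F (𝓝[>] 0) (𝓝 (f x)) := by
    have hle : ∀ s : ℝ, 0 < s → ‖F s - f x‖ ≤
        B * r₀ ^ d * ω * ⨍ y in closedBall x (s * r₀), ‖f y - f x‖ := by
      intro s hs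
      -- A non-integrable function would have integral `0` by convention, not `1`.
      have hk : Integrable fun w => (s ^ d)⁻¹ * κ (s⁻¹ • (w - x)) := by
        by_contra hcon
        have := hint s hs
        rw [integral_undef hcon] at this
        exact zero_ne_one this
      have hkm : AEStronglyMeasurable (fun w => (s ^ d)⁻¹ * κ (s⁻¹ • (w - x))) :=
        hk.aestronglyMeasurable
      have hfk : Integrable fun w => f w * ((s ^ d)⁻¹ * κ (s⁻¹ • (w - x))) :=
        hf.mul_bdd (c := (s ^ d)⁻¹ * B) hkm (Eventually.of_forall fun w => by
          rw [Real.norm_of_nonneg (mul_nonneg (by positivity) (hκ0 _))]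
          gcongr
          exact hκB _)
      have e1 : F s - f x = ∫ w, (f w - f x) * ((s ^ d)⁻¹ * κ (s⁻¹ • (w - x))) := by
        simp_rw [sub_mul]
        rw [integral_sub hfk (hk.const_mul _), integral_const_mul, hint s hs, mul_one]
      have hloc : IntegrableOn (fun w => ‖f w - f x‖) (closedBall x (s * r₀)) :=
        (hf.integrableOn.sub (integrableOn_const measure_closedBall_lt_top.ne)).norm
      have h1 : ‖F s - f x‖ ≤
          ∫ w, (closedBall x (s * r₀)).indicator (fun w => (s ^ d)⁻¹ * B * ‖f w - f x‖) w := by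
        rw [e1]
        refine norm_integral_le_of_norm_le
          ((integrable_indicator_iff measurableSet_closedBall).2 (hloc.const_mul _))
          (Eventually.of_forall fun w => ?_)
        by_cases hwm : w ∈ closedBall x (s * r₀)
        · rw [Set.indicator_of_mem hwm, norm_mul, mul_comm,
            Real.norm_of_nonneg (mul_nonneg (by positivity) (hκ0 _))]
          gcongr
          exact hκB _
        · rw [Set.indicator_of_notMem hwm, hκout _ fun h => hwm ((hzmem hs w).1 h)]
          simp
      rw [integral_indicator measurableSet_closedBall, integral_const_mul] at h1
      refine h1.trans_eq ?_
      have hω : 0 < ω := by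
        have := hvol 1 zero_le_one
        rw [one_pow, one_mul] at this
        rw [← this]
        exact ENNReal.toReal_pos (measure_closedBall_pos _ _ one_pos).ne'
          measure_closedBall_lt_top.ne
      rw [setAverage_eq, hvol _ (by positivity), smul_eq_mul, mul_pow]
      field_simp
    rw [tendsto_iff_norm_sub_tendsto_zero]
    have hscale : Tendsto (fun s : ℝ => s * r₀) (𝓝[>] 0) (𝓝[>] 0) := by
      refine tendsto_nhdsWithin_iff.2 ⟨?_, ?_⟩
      · have : Tendsto (fun s : ℝ => s * r₀) (𝓝 0) (𝓝 (0 * r₀)) :=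
          (continuous_id.mul continuous_const).tendsto 0
        rw [zero_mul] at this
        exact this.mono_left nhdsWithin_le_nhds
      · filter_upwards [self_mem_nhdsWithin] with s hs
        exact mul_pos hs hr₀
    have h0 := (hleb.comp hscale).const_mul (B * r₀ ^ d * ω)
    rw [mul_zero] at h0
    refine squeeze_zero' (Eventually.of_forall fun _ => norm_nonneg _) ?_ h0
    filter_upwards [self_mem_nhdsWithin] with s hs using hle s hs
  have hF1 : F 1 = ∫ w, f w * κ (w - x) := by simp [hF]
  rw [← hF1, ← Real.norm_eq_abs]
  refine le_of_tendsto (hlim.sub_const (F 1)).norm ?_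
  filter_upwards [Ioc_mem_nhdsGT one_pos] with s hs using hmv s hs

end ConeAverages

/-! ### Interior cones and the pointwise estimate. -/

section InteriorCone

open Metric Filter Topology

variable {d : ℕ}

/-- Near each point of its closure, a smooth domain contains cones with a common direction. -/
theorem IsSmoothBoundedDomain.exists_local_cone {S : Set (EuclideanSpace ℝ (Fin d))}
    (hS : IsSmoothBoundedDomain S) {x₀ : EuclideanSpace ℝ (Fin d)} (hx₀ : x₀ ∈ closure S) :
    ∃ r > 0, ∃ q : EuclideanSpace ℝ (Fin d), ∀ y ∈ S ∩ ball x₀ r, ∀ t : ℝ, 0 ≤ t → t ≤ 2 * r →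
      ∀ s : ℝ, 0 < s → s ≤ 1 → ∀ u : EuclideanSpace ℝ (Fin d), ‖u‖ ≤ 2 * t →
        y + s • (t • q + u) ∈ S := by
  rw [closure_eq_self_union_frontier] at hx₀
  rcases hx₀ with hx₀ | hx₀
  · obtain ⟨ρ, hρ, hball⟩ := Metric.isOpen_iff.1 hS.isOpen x₀ hx₀
    -- With `r = ρ / 5` one has `‖u‖ ≤ 2 * t ≤ 4 * r`, and `r + 4 * r = ρ`; no direction is needed
    -- in the interior.
    refine ⟨ρ / 5, by positivity, 0, fun y hy t ht htr s hs hs1 u hu => hball ?_⟩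
    have hy2 := mem_ball_iff_norm.1 hy.2
    rw [smul_zero, zero_add, mem_ball_iff_norm, add_sub_right_comm]
    calc ‖y - x₀ + s • u‖ ≤ ‖y - x₀‖ + ‖s • u‖ := norm_add_le _ _
      _ ≤ ‖y - x₀‖ + ‖u‖ := by
          gcongr
          rw [norm_smul, Real.norm_of_nonneg hs.le]
          exact mul_le_of_le_one_left (norm_nonneg _) hs1
      _ < ρ := by linarith
  · obtain ⟨r, hr, e, γ, he, hγ, hgraph⟩ := hS.hasSmoothBoundary x₀ hx₀
    set Γ : EuclideanSpace ℝ (Fin d) → ℝ := fun y => γ (y - inner ℝ e y • e) with hΓ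
    have hΓc : ContDiff ℝ 1 Γ :=
      (hγ.of_le (by exact_mod_cast le_top)).comp
        (contDiff_id.sub ((contDiff_const.inner ℝ contDiff_id).smul contDiff_const))
    obtain ⟨L, V, hV, hL⟩ := hΓc.contDiffAt.exists_lipschitzOnWith (x := x₀)
    obtain ⟨r₁, hr₁, hr₁V⟩ := Metric.mem_nhds_iff.1 hV
    have hmin : 0 < min r r₁ := lt_min hr hr₁
    have hL0 : (0 : ℝ) ≤ L := L.2
    -- A step `s • (t • K • e + u)` raises the height by at least `s * t * (K - 2)` and the graph by
    -- at most `2 * L * s * t`. This `K` balances the two, so the strict inequality at `y` persists.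
    set K : ℝ := 2 + 2 * L with hK
    have hden : 0 < 1 + 2 * (K + 2) := by positivity
    refine ⟨min r r₁ / (1 + 2 * (K + 2)), by positivity, K • e,
      fun y hy t ht htr s hs hs1 u hu => ?_⟩
    set r' := min r r₁ / (1 + 2 * (K + 2))
    have hr' : r' + (K + 2) * (2 * r') = min r r₁ := by
      simp only [r']
      field_simp
    have hKt : (K + 2) * t ≤ (K + 2) * (2 * r') := by gcongr
    have hy2 := mem_ball_iff_norm.1 hy.2
    have hmem : ∀ v : EuclideanSpace ℝ (Fin d), ‖v‖ ≤ (K + 2) * t →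
        y + s • v ∈ ball x₀ (min r r₁) := by
      intro v hv
      rw [mem_ball_iff_norm, add_sub_right_comm]
      calc ‖y - x₀ + s • v‖ ≤ ‖y - x₀‖ + ‖s • v‖ := norm_add_le _ _
        _ ≤ ‖y - x₀‖ + ‖v‖ := by
            gcongr
            rw [norm_smul, Real.norm_of_nonneg hs.le]
            exact mul_le_of_le_one_left (norm_nonneg _) hs1
        _ < min r r₁ := by linarith
    have hK0 : 0 ≤ K := by positivity
    have hKt0 : 0 ≤ K * t := by positivity
    have h1 : y + s • (t • K • e + u) ∈ ball x₀ r := by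
      refine ball_subset_ball (min_le_left r r₁) (hmem _ ((norm_add_le _ _).trans ?_))
      rw [norm_smul, norm_smul, he, Real.norm_of_nonneg ht, Real.norm_of_nonneg hK0]
      linarith
    have h2 : y + s • u ∈ ball x₀ r₁ :=
      ball_subset_ball (min_le_right r r₁) (hmem _ (by linarith))
    have h3 : y ∈ ball x₀ (min r r₁) := by
      have := hmem 0 (by rw [norm_zero]; positivity)
      rwa [smul_zero, add_zero] at this
    have hyS : Γ y < inner ℝ e y := (hgraph y (ball_subset_ball (min_le_left r r₁) h3)).1 hy.1
    have hlip : Γ (y + s • u) ≤ Γ y + L * (s * (2 * t)) := by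
      have h4 := hL.dist_le_mul _ (hr₁V h2) _ (hr₁V (ball_subset_ball (min_le_right r r₁) h3))
      rw [Real.dist_eq, dist_eq_norm, add_sub_cancel_left, norm_smul,
        Real.norm_of_nonneg hs.le] at h4
      have h5 : L * (s * ‖u‖) ≤ L * (s * (2 * t)) := by gcongr
      linarith [le_abs_self (Γ (y + s • u) - Γ y)]
    have hee : inner ℝ e e = (1 : ℝ) := by rw [real_inner_self_eq_norm_sq, he, one_pow]
    have hue : -(2 * t) ≤ inner ℝ e u := by
      have := (abs_real_inner_le_norm e u)
      rw [he, one_mul] at this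
      linarith [neg_abs_le (inner ℝ e u : ℝ)]
    have hinner : (inner ℝ e (y + s • (t • K • e + u)) : ℝ) =
        inner ℝ e y + s * (t * K + inner ℝ e u) := by
      simp only [inner_add_right, inner_smul_right, hee]
      ring
    rw [hgraph _ h1]
    -- The graph function sees only the component orthogonal to `e`, so the push along `e` drops out
    -- and only `u` moves it.
    have hΓeq : γ (y + s • (t • K • e + u) - (inner ℝ e (y + s • (t • K • e + u)) : ℝ) • e) =
        Γ (y + s • u) := by
      simp only [hΓ]
      congr 1
      rw [hinner, inner_add_right, inner_smul_right]
      module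
    rw [hΓeq, hinner]
    have h6 : s * (t * K + -(2 * t)) ≤ s * (t * K + inner ℝ e u) := by gcongr
    have h7 : s * (t * K + -(2 * t)) = L * (s * (2 * t)) := by rw [hK]; ring
    linarith

/-- A smooth bounded domain contains cones with a common direction at nearby points. -/
theorem IsSmoothBoundedDomain.exists_uniform_cone {S : Set (EuclideanSpace ℝ (Fin d))}
    (hS : IsSmoothBoundedDomain S) :
    ∃ K ≥ 0, ∃ δ > 0, ∀ x ∈ S, ∀ y ∈ S, ‖x - y‖ < δ → ∃ q : EuclideanSpace ℝ (Fin d), ‖q‖ ≤ K ∧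
      ∀ z, z = x ∨ z = y → ∀ s : ℝ, 0 < s → s ≤ 1 → ∀ u : EuclideanSpace ℝ (Fin d),
        ‖u‖ ≤ 2 * ‖x - y‖ → z + s • (‖x - y‖ • q + u) ∈ S := by
  choose! r hr q hq using fun x₀ (hx₀ : x₀ ∈ closure S) => hS.exists_local_cone hx₀
  have hcomp : IsCompact (closure S) := hS.isBounded.isCompact_closure
  obtain ⟨T, hT, hcov⟩ := hcomp.elim_nhds_subcover (fun x => ball x (r x))
    fun x hx => ball_mem_nhds x (hr x hx)
  have hcov' : closure S ⊆ ⋃ i : T, ball (i : EuclideanSpace ℝ (Fin d)) (r i) := fun x hx => by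
    simpa [and_assoc] using hcov hx
  -- A Lebesgue number places two points closer than `δ` in one ball of the finite cover: they share
  -- its direction, and their distance is below twice its radius, as the local cones require.
  obtain ⟨δ, hδ, hleb⟩ := lebesgue_number_lemma_of_metric hcomp
    (fun i : T => isOpen_ball) hcov'
  refine ⟨∑ i ∈ T, ‖q i‖, Finset.sum_nonneg fun _ _ => norm_nonneg _, δ, hδ,
    fun x hx y hy hxy => ?_⟩
  obtain ⟨⟨i, hi⟩, hball⟩ := hleb x (subset_closure hx)
  have hxi : x ∈ ball i (r i) := hball (mem_ball_self hδ)
  have hyi : y ∈ ball i (r i) := hball (by rwa [mem_ball_iff_norm'])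
  refine ⟨q i, Finset.single_le_sum (f := fun i => ‖q i‖) (fun _ _ => norm_nonneg _) hi,
    fun z hz s hs hs1 u hu => hq i (hT i hi) z ?_ _ (norm_nonneg _) ?_ s hs hs1 u hu⟩
  · rcases hz with rfl | rfl
    exacts [⟨hx, hxi⟩, ⟨hy, hyi⟩]
  · rw [← dist_eq_norm]
    have h1 := mem_ball.1 hxi
    have h2 := mem_ball.1 hyi
    linarith [dist_triangle_right x y i]

/-- The pointwise estimate for a weakly differentiable function at two points which are the
vertices of two parallel cones. -/
theorem abs_sub_le_of_cone {S : Set (EuclideanSpace ℝ (Fin d))}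
    {f : EuclideanSpace ℝ (Fin d) → ℝ} {G : EuclideanSpace ℝ (Fin d) → EuclideanSpace ℝ (Fin d)}
    (hf : Integrable f) (hG : Integrable G)
    (hw : ∀ φ : EuclideanSpace ℝ (Fin d) → ℝ, ContDiff ℝ (⊤ : ℕ∞) φ → HasCompactSupport φ →
      tsupport φ ⊆ S → ∀ i : Fin d,
      ∫ x, f x * fderiv ℝ φ x (EuclideanSpace.single i 1) = - ∫ x, G x i * φ x)
    {x y q : EuclideanSpace ℝ (Fin d)} {K t : ℝ} (ht : 0 < t) (hxy : ‖x - y‖ = t) (hK : 0 ≤ K)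
    (hq : ‖q‖ ≤ K)
    (hcone : ∀ z, z = x ∨ z = y → ∀ s : ℝ, 0 < s → s ≤ 1 → ∀ u : EuclideanSpace ℝ (Fin d),
        ‖u‖ ≤ 2 * t → z + s • (t • q + u) ∈ S)
    {m : EuclideanSpace ℝ (Fin d) → ℝ}
    (hleb : ∀ z, z = x ∨ z = y →
      Tendsto (fun r => ⨍ w in closedBall z r, ‖f w - f z‖) (𝓝[>] 0) (𝓝 0))
    (hm : ∀ z, z = x ∨ z = y → ∀ r, 0 < r → r ≤ (K + 2) * t →
      ∫ w in closedBall z r, ‖G w‖ ≤ volume.real (closedBall z (2 * r)) * m z) :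
    |f x - f y| ≤ (K + 2) * (4 * (K + 2)) ^ d * t * (m x + m y) := by
  set ω := volume.real (ball (0 : EuclideanSpace ℝ (Fin d)) 1) with hωdef
  have hω : 0 < ω := ENNReal.toReal_pos (measure_ball_pos _ _ one_pos).ne' measure_ball_lt_top.ne
  let β : ContDiffBump (0 : EuclideanSpace ℝ (Fin d)) :=
    ⟨t / 2, t, by positivity, by linarith⟩
  set b := β.normed volume with hb
  have hvol : volume.real (closedBall (0 : EuclideanSpace ℝ (Fin d)) (t / 2)) =
      (t / 2) ^ d * ω := by
    rw [Measure.addHaar_real_closedBall _ _ (by positivity), finrank_euclideanSpace_fin]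
  have key : ∀ z, z = x ∨ z = y → |f z - ∫ w, f w * b (w - (x + t • q))| ≤
      (K + 2) * (4 * (K + 2)) ^ d * t * m z := by
    intro z hz
    have hxz : ‖x - z‖ ≤ t := by
      rcases hz with rfl | rfl
      · simp [ht.le]
      · exact hxy.le
    -- Seen from `z` the bump is centred at `c`, but in absolute position it is centred at `x + t •
    -- q` for both vertices. Replacing `y` by `x` as reference costs a shift of at most `t`, which
    -- with the bump radius `t` uses up the aperture `2 * t`.
    set c := x + t • q - z with hc
    have hts : ∀ u ∈ tsupport (fun u => b (u - c)), ‖u - c‖ ≤ t := by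
      intro u hu
      have h1 := tsupport_comp_subset_preimage b (f := fun u => u - c) (by fun_prop) hu
      have h2 : u - c ∈ tsupport b := h1
      rw [hb, β.tsupport_normed_eq] at h2
      exact mem_closedBall_zero_iff.1 h2
    have hmain := abs_sub_integral_kernel_le (S := S) hf hG hw (κ := fun u => b (u - c))
      (β.contDiff_normed.comp (contDiff_id.sub contDiff_const))
      (fun u => β.nonneg_normed _) (B := 1 / ((t / 2) ^ d * ω))
      (fun u => (β.normed_le_div_measure_closedBall_rIn volume _).trans_eq (by rw [← hvol]))
      (by rw [integral_sub_right_eq_self]; exact β.integral_normed)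
      (r₀ := (K + 2) * t) (by positivity)
      (fun u hu => by
        rw [mem_closedBall_zero_iff]
        have h1 := hts u hu
        have h2 : u = (u - c) + ((x - z) + t • q) := by rw [hc]; abel
        rw [h2]
        refine (norm_add_le _ _).trans ?_
        have h3 : ‖(x - z) + t • q‖ ≤ t + t * K := by
          refine (norm_add_le _ _).trans ?_
          rw [norm_smul, Real.norm_of_nonneg ht.le]
          gcongr
        linarith)
      (hleb z hz)
      (fun s hs hs1 u hu => by
        have h2 : u = t • q + ((u - c) + (x - z)) := by rw [hc]; abel
        rw [h2]
        refine hcone z hz s hs hs1 _ ((norm_add_le _ _).trans ?_)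
        linarith [hts u hu])
      (hm z hz)
    have e1 : ∀ w, w - z - c = w - (x + t • q) := fun w => by rw [hc]; abel
    simp only [e1] at hmain
    refine hmain.trans_eq ?_
    -- The factor `(t / 2) ^ d` cancels the height of the normalized bump, so only one power of `t`
    -- survives.
    rw [show 2 * ((K + 2) * t) = (4 * (K + 2)) * (t / 2) by ring, mul_pow _ (t / 2)]
    rw [← hωdef]
    field_simp
  have h1 := key x (Or.inl rfl)
  have h2 := key y (Or.inr rfl)
  rw [abs_sub_comm] at h2
  refine (abs_sub_le _ (∫ w, f w * b (w - (x + t • q))) _).trans ?_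
  linarith

/-- Weakly differentiable functions on a smooth bounded domain satisfy a pointwise Hajłasz
estimate at small distances. -/
theorem IsSmoothBoundedDomain.exists_hajlasz_gradient {S : Set (EuclideanSpace ℝ (Fin d))}
    (hS : IsSmoothBoundedDomain S) {p : ENNReal} (hp : 1 < p) (hp_top : p ≠ ⊤)
    {f : EuclideanSpace ℝ (Fin d) → ℝ} {G : EuclideanSpace ℝ (Fin d) → EuclideanSpace ℝ (Fin d)}
    (hf : Integrable f) (hG : Integrable G) (hGp : MemLp G p)
    (hw : ∀ φ : EuclideanSpace ℝ (Fin d) → ℝ, ContDiff ℝ (⊤ : ℕ∞) φ → HasCompactSupport φ →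
      tsupport φ ⊆ S → ∀ i : Fin d,
      ∫ x, f x * fderiv ℝ φ x (EuclideanSpace.single i 1) = - ∫ x, G x i * φ x) :
    ∃ δ > 0, ∃ (N : Set (EuclideanSpace ℝ (Fin d))) (m : EuclideanSpace ℝ (Fin d) → ℝ),
      volume N = 0 ∧ (∀ x, 0 ≤ m x) ∧ MemLp m p ∧
      ∀ x ∈ S \ N, ∀ y ∈ S \ N, ‖x - y‖ < δ → |f x - f y| ≤ ‖x - y‖ * (m x + m y) := by
  obtain ⟨K, hK, δ, hδ, hcone⟩ := hS.exists_uniform_cone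
  obtain ⟨m, hm0, hmp, hm⟩ := exists_memLp_forall_integral_ball_le volume hp hp_top
    (g := fun x => ‖G x‖) (fun x => norm_nonneg _) hG.norm hGp.norm (2 * ((K + 2) * δ))
  have hleb : ∀ᵐ z, Tendsto (fun r => ⨍ w in closedBall z r, ‖f w - f z‖) (𝓝[>] 0) (𝓝 0) := by
    filter_upwards [IsUnifLocDoublingMeasure.ae_tendsto_average_norm_sub volume
      hf.locallyIntegrable 1] with z hz
    refine hz (fun _ => z) id tendsto_id ?_
    filter_upwards [self_mem_nhdsWithin] with r hr
    exact mem_closedBall_self (by simpa using (Set.mem_Ioi.1 hr).le)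
  obtain ⟨N, hN0, hN⟩ : ∃ N : Set (EuclideanSpace ℝ (Fin d)), volume N = 0 ∧ ∀ z ∉ N,
      (∀ r, 0 < r → 2 * r ≤ 2 * ((K + 2) * δ) →
        ∫ w in closedBall z r, ‖G w‖ ≤ volume.real (closedBall z (2 * r)) * m z) ∧
      Tendsto (fun r => ⨍ w in closedBall z r, ‖f w - f z‖) (𝓝[>] 0) (𝓝 0) :=
    ⟨_, ae_iff.1 (hm.and hleb), fun z hz => not_not.1 hz⟩
  set C : ℝ := (K + 2) * (4 * (K + 2)) ^ d
  have hC : 0 ≤ C := by positivity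
  refine ⟨δ, hδ, N, fun x => C * m x, hN0, fun x => mul_nonneg hC (hm0 x),
    hmp.const_mul C, fun x hx y hy hxy => ?_⟩
  rcases eq_or_ne x y with rfl | hne
  · simp
  have ht : 0 < ‖x - y‖ := norm_pos_iff.2 (sub_ne_zero.2 hne)
  obtain ⟨q, hq, hqcone⟩ := hcone x hx.1 y hy.1 hxy
  have hgood : ∀ z, z = x ∨ z = y → (∀ r, 0 < r → 2 * r ≤ 2 * ((K + 2) * δ) →
      ∫ w in closedBall z r, ‖G w‖ ≤ volume.real (closedBall z (2 * r)) * m z) ∧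
      Tendsto (fun r => ⨍ w in closedBall z r, ‖f w - f z‖) (𝓝[>] 0) (𝓝 0) := by
    intro z hz
    refine hN z ?_
    rcases hz with rfl | rfl
    exacts [hx.2, hy.2]
  refine (abs_sub_le_of_cone hf hG hw ht rfl hK hq hqcone (m := m) (fun z hz => (hgood z hz).2)
    fun z hz r hr hrt => (hgood z hz).1 r hr ?_).trans_eq ?_
  · have : (K + 2) * ‖x - y‖ ≤ (K + 2) * δ := by gcongr
    linarith
  · ring

end InteriorCone

/-! ### Weak derivatives from a Hajłasz gradient. -/

section HajlaszToSobolev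

open Metric Filter Topology

/-- A linear functional dominated by a multiple of the `L¹` norm is represented by a bounded
function. -/
theorem exists_density_of_le_integral_abs {α : Type*} [MeasurableSpace α] {m : Measure α}
    [IsFiniteMeasure m] {T : Type*} [AddCommGroup T] [Module ℝ T] (j : T →ₗ[ℝ] α → ℝ)
    (hj : ∀ φ, MemLp (j φ) 2 m) (l : T →ₗ[ℝ] ℝ) {C : ℝ}
    (hl : ∀ φ, l φ ≤ C * ∫ x, |j φ x| ∂m) (hC : 0 ≤ C) :
    ∃ h : α → ℝ, StronglyMeasurable h ∧ (∀ᵐ x ∂m, |h x| ≤ C) ∧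
      ∀ φ, l φ = ∫ x, h x * j φ x ∂m := by
  -- Working in `L²` makes Riesz representation available. As `m` is finite, the `L¹` bound is
  -- continuous there by Cauchy-Schwarz against the constant `1`.
  let J : T →ₗ[ℝ] Lp ℝ 2 m :=
    { toFun := fun φ => (hj φ).toLp
      map_add' := fun φ ψ => by
        rw [← MemLp.toLp_add]
        exact MemLp.toLp_congr _ _ (by rw [map_add])
      map_smul' := fun c φ => by
        rw [RingHom.id_apply, ← MemLp.toLp_const_smul]
        exact MemLp.toLp_congr _ _ (by rw [map_smul]) }
  have hJ : ∀ φ, J φ =ᵐ[m] j φ := fun φ => (hj φ).coeFn_toLp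
  have habs : ∀ {u v : α → ℝ}, u =ᵐ[m] v → ∫ x, |u x| ∂m = ∫ x, |v x| ∂m := fun huv =>
    integral_congr_ae (huv.fun_comp fun t => |t|)
  have hJabs : ∀ φ, ∫ x, |j φ x| ∂m = ∫ x, |J φ x| ∂m := fun φ => habs (hJ φ).symm
  have hint : ∀ F : Lp ℝ 2 m, Integrable F m := fun F =>
    (Lp.memLp F).integrable (by norm_num)
  -- Functions equal almost everywhere must have the same image under `l` for it to descend to the
  -- range of `J`; the one-sided bound suffices, applied to `φ` and `-φ`.
  have hker : J.ker ≤ l.ker := by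
    intro φ hφ
    have h0 : ∀ ψ, J ψ = 0 → l ψ ≤ 0 := fun ψ hψ => by
      have h1 := hl ψ
      have h2 : ∫ x, |J ψ x| ∂m = 0 := by
        rw [hψ, habs (Lp.coeFn_zero ℝ 2 m)]
        simp
      rwa [hJabs, h2, mul_zero] at h1
    have h1 := h0 φ hφ
    have h2 := h0 (-φ) (by rw [map_neg, LinearMap.mem_ker.1 hφ, neg_zero])
    rw [map_neg] at h2
    exact LinearMap.mem_ker.2 (le_antisymm h1 (by linarith))
  let f : Lp ℝ 2 m →ₗ.[ℝ] ℝ :=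
    ⟨J.range, (J.ker.liftQ l hker) ∘ₗ (J.quotKerEquivRange.symm : _ →ₗ[ℝ] _)⟩
  have hf : ∀ φ, f ⟨J φ, LinearMap.mem_range_self J φ⟩ = l φ := fun φ => by
    change (J.ker.liftQ l hker) (J.quotKerEquivRange.symm ⟨J φ, LinearMap.mem_range_self J φ⟩) = _
    rw [LinearMap.quotKerEquivRange_symm_apply_image]
    simp
  obtain ⟨g, hgf, hgN⟩ := exists_extension_of_le_sublinear f (fun F => C * ∫ x, |F x| ∂m)
    (fun c hc F => by
      rw [habs (Lp.coeFn_smul c F)]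
      simp only [Pi.smul_apply, smul_eq_mul, abs_mul, abs_of_pos hc]
      rw [integral_const_mul]
      ring)
    (fun F F' => by
      rw [← mul_add, ← integral_add (hint F).abs (hint F').abs]
      refine mul_le_mul_of_nonneg_left ?_ hC
      refine integral_mono_ae (hint _).abs ((hint F).abs.add (hint F').abs) ?_
      filter_upwards [Lp.coeFn_add F F'] with x hx
      rw [hx]
      exact abs_add_le _ _)
    (fun ⟨F, hF⟩ => by
      obtain ⟨φ, rfl⟩ := hF
      rw [hf, ← hJabs]
      exact hl φ)
  have hgbound : ∀ F : Lp ℝ 2 m, ‖g F‖ ≤ C * ‖(memLp_const (1 : ℝ) (p := 2) (μ := m)).toLp‖ * ‖F‖ := by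
    have h1 : ∀ F : Lp ℝ 2 m, g F ≤
        C * ‖(memLp_const (1 : ℝ) (p := 2) (μ := m)).toLp‖ * ‖F‖ := fun F => by
      refine (hgN F).trans ?_
      have h2 : ∫ x, |F x| ∂m = inner ℝ ((memLp_const (1 : ℝ) (p := 2) (μ := m)).toLp) |F| := by
        rw [L2.inner_def]
        refine integral_congr_ae ?_
        filter_upwards [Lp.coeFn_abs F, (memLp_const (1 : ℝ) (p := 2) (μ := m)).coeFn_toLp]
          with x h3 h4
        rw [h3, h4]
        simp
      rw [h2, mul_assoc]
      refine mul_le_mul_of_nonneg_left ((real_inner_le_norm _ _).trans ?_) hC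
      rw [norm_abs_eq_norm]
    intro F
    rw [Real.norm_eq_abs, abs_le]
    refine ⟨?_, h1 F⟩
    have := h1 (-F)
    rw [map_neg, norm_neg] at this
    linarith
  set H : Lp ℝ 2 m := (InnerProductSpace.toDual ℝ (Lp ℝ 2 m)).symm (g.mkContinuous _ hgbound)
  have hH : ∀ F : Lp ℝ 2 m, inner ℝ H F = g F := fun F => by
    rw [InnerProductSpace.toDual_symm_apply]
    rfl
  -- Testing the extended functional on indicators recovers the pointwise bound by `C`, which the
  -- `L²` norm alone would not give.
  have hind : ∀ s (hs : MeasurableSet s), |∫ x in s, H x ∂m| ≤ ∫ _ in s, C ∂m := by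
    intro s hs
    have hsm : m s ≠ ⊤ := measure_ne_top m s
    have h1 : ∀ F : Lp ℝ 2 m, |g F| ≤ C * ∫ x, |F x| ∂m := fun F => by
      refine abs_le'.2 ⟨hgN F, ?_⟩
      rw [← map_neg]
      refine (hgN _).trans_eq ?_
      rw [habs (Lp.coeFn_neg F)]
      simp
    rw [← L2.inner_indicatorConstLp_one (𝕜 := ℝ) hs hsm H, real_inner_comm, hH]
    refine (h1 _).trans_eq ?_
    rw [habs (indicatorConstLp_coeFn (hs := hs) (hμs := hsm))]
    have h2 : ∀ x, |s.indicator (fun _ => (1 : ℝ)) x| = s.indicator (fun _ => (1 : ℝ)) x :=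
      fun x => abs_of_nonneg (Set.indicator_nonneg (fun _ _ => zero_le_one) x)
    simp only [h2]
    rw [integral_indicator hs]
    simp [mul_comm]
  refine ⟨H, Lp.stronglyMeasurable H, ?_, fun φ => ?_⟩
  · have h1 := ae_le_of_forall_setIntegral_le (hint H) (integrable_const C)
      fun s hs _ => (le_abs_self _).trans (hind s hs)
    have h2 := ae_le_of_forall_setIntegral_le (f := fun x => -H x) (hint H).neg (integrable_const C)
      fun s hs _ => by
        rw [integral_neg]
        exact (neg_le_abs _).trans (hind s hs)
    filter_upwards [h1, h2] with x h3 h4 using abs_le'.2 ⟨h3, h4⟩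
  · rw [← hf φ, ← hgf, ← hH, L2.inner_def]
    refine integral_congr_ae ?_
    filter_upwards [hJ φ] with x hx
    change inner ℝ (H x) (J φ x) = _
    rw [hx]
    simp [mul_comm]

variable {d : ℕ}

/-- Difference quotients bound the weak derivative of a function with a Hajłasz gradient. -/
theorem integral_mul_fderiv_le_of_hajlasz {S N : Set (EuclideanSpace ℝ (Fin d))} (hS : IsOpen S)
    (hN : volume N = 0) {f g : EuclideanSpace ℝ (Fin d) → ℝ} (hf : Integrable f)
    (hg : Integrable g)
    (hfg : ∀ x ∈ S \ N, ∀ y ∈ S \ N, |f x - f y| ≤ ‖x - y‖ * (g x + g y))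
    {φ : EuclideanSpace ℝ (Fin d) → ℝ} (hφ : ContDiff ℝ (⊤ : ℕ∞) φ) (hφc : HasCompactSupport φ)
    (hφS : tsupport φ ⊆ S) {e : EuclideanSpace ℝ (Fin d)} (he : ‖e‖ = 1) :
    ∫ x, f x * fderiv ℝ φ x e ≤ 2 * ∫ x, g x * |φ x| := by
  obtain ⟨L, hL⟩ := hφ.lipschitzWith_of_hasCompactSupport hφc (by simp)
  obtain ⟨B, hB⟩ := hφc.exists_bound_of_continuous hφ.continuous
  have hφcont := hφ.continuous
  have htrans : ∀ {F : EuclideanSpace ℝ (Fin d) → ℝ} (hF : Integrable F) (a : ℝ),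
      Integrable fun x => F x * φ (x + a • e) := fun hF a =>
    hF.mul_bdd (c := B) (Continuous.aestronglyMeasurable (by fun_prop))
      (Eventually.of_forall fun x => hB _)
  have htrans' : ∀ (a : ℝ), Integrable fun x => g x * |φ (x + a • e)| := fun a =>
    hg.mul_bdd (c := B) (Continuous.aestronglyMeasurable (by fun_prop))
      (Eventually.of_forall fun x => by simpa using hB _)
  -- The quotient of `φ` tends to its derivative; at fixed `t`, translation invariance moves the
  -- quotient onto `f`, where the Hajłasz inequality cancels `t⁻¹`.
  have hlim1 : Tendsto (fun t : ℝ => ∫ x, f x * (t⁻¹ * (φ (x + t • e) - φ x))) (𝓝[>] 0)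
      (𝓝 (∫ x, f x * fderiv ℝ φ x e)) := by
    refine tendsto_integral_filter_of_dominated_convergence (fun x => ‖f x‖ * L)
      (Eventually.of_forall fun t => hf.aestronglyMeasurable.mul
        (Continuous.aestronglyMeasurable (by fun_prop))) ?_ (hf.norm.mul_const _)
      (Eventually.of_forall fun x => ?_)
    · filter_upwards [self_mem_nhdsWithin] with t ht
      have ht : 0 < t := ht
      refine Eventually.of_forall fun x => ?_
      rw [norm_mul, norm_mul, norm_inv, Real.norm_of_nonneg ht.le]
      have h1 := hL.dist_le_mul (x + t • e) x
      rw [dist_eq_norm, dist_eq_norm, add_sub_cancel_left, norm_smul, he, mul_one,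
        Real.norm_of_nonneg ht.le] at h1
      gcongr
      rw [inv_mul_le_iff₀ ht]
      linarith
    · have h1 := ((hφ.differentiable (by simp)) x).hasFDerivAt.hasLineDerivAt e
      exact (h1.tendsto_slope_zero.mono_left
        (nhdsWithin_mono _ fun t (ht : 0 < t) => ht.ne')).const_mul (f x)
  have hlim2 : Tendsto (fun t : ℝ => ∫ x, g x * (|φ (x + t • e)| + |φ x|)) (𝓝[>] 0)
      (𝓝 (∫ x, g x * (|φ x| + |φ x|))) := by
    refine tendsto_integral_filter_of_dominated_convergence (fun x => ‖g x‖ * (B + B))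
      (Eventually.of_forall fun t => hg.aestronglyMeasurable.mul
        (Continuous.aestronglyMeasurable (by fun_prop))) ?_ (hg.norm.mul_const _)
      (Eventually.of_forall fun x => ?_)
    · refine Eventually.of_forall fun t => Eventually.of_forall fun x => ?_
      rw [norm_mul, Real.norm_of_nonneg (add_nonneg (abs_nonneg (φ (x + t • e))) (abs_nonneg _))]
      gcongr
      exacts [hB _, hB _]
    · have hc : Continuous fun t : ℝ => g x * (|φ (x + t • e)| + |φ x|) := by fun_prop
      have := hc.tendsto 0
      rw [zero_smul, add_zero] at this
      exact this.mono_left nhdsWithin_le_nhds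
  have e1 : ∫ x, g x * (|φ x| + |φ x|) = 2 * ∫ x, g x * |φ x| := by
    rw [← integral_const_mul]
    congr 1
    ext x
    ring
  rw [← e1]
  refine le_of_tendsto_of_tendsto hlim1 hlim2 ?_
  -- For `t ≤ ε` the shifted point stays in `S` whenever `x` is in the support of `φ`, so the
  -- pointwise inequality applies to the pair.
  obtain ⟨ε, hε, hεS⟩ := hφc.isCompact.exists_cthickening_subset_open hS hφS
  filter_upwards [Ioc_mem_nhdsGT hε] with t ht
  have ht0 : 0 < t := ht.1
  have hshift : ∀ F : EuclideanSpace ℝ (Fin d) → ℝ, ∀ ψ : EuclideanSpace ℝ (Fin d) → ℝ,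
      ∫ x, F x * ψ (x + t • e) = ∫ x, F (x - t • e) * ψ x := fun F ψ => by
    rw [← integral_sub_right_eq_self (fun x => F x * ψ (x + t • e)) (t • e)]
    simp
  have hshiftint : ∀ {F ψ : EuclideanSpace ℝ (Fin d) → ℝ}, Integrable (fun x => F x * ψ (x + t • e)) →
      Integrable fun x => F (x - t • e) * ψ x := fun hF => by
    simpa using hF.comp_sub_right (t • e)
  have hφ0 : ∀ {F : EuclideanSpace ℝ (Fin d) → ℝ}, Integrable F →
      Integrable fun x => F x * φ x := fun hF => by simpa using htrans hF 0
  have hφ0' : Integrable fun x => g x * |φ x| := by simpa using htrans' 0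
  have e2 : ∫ x, f x * (t⁻¹ * (φ (x + t • e) - φ x)) =
      ∫ x, t⁻¹ * ((f (x - t • e) - f x) * φ x) := by
    have h1 : ∀ x, f x * (t⁻¹ * (φ (x + t • e) - φ x)) =
        t⁻¹ * (f x * φ (x + t • e) - f x * φ x) := fun x => by ring
    simp only [h1, sub_mul]
    rw [integral_const_mul, integral_const_mul, integral_sub (htrans hf t) (hφ0 hf),
      integral_sub (hshiftint (htrans hf t)) (hφ0 hf), hshift]
  have e3 : ∫ x, g x * (|φ (x + t • e)| + |φ x|) = ∫ x, (g (x - t • e) + g x) * |φ x| := by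
    simp only [mul_add, add_mul]
    rw [integral_add (htrans' t) hφ0', integral_add
      (hshiftint (ψ := fun x => |φ x|) (htrans' t)) hφ0', hshift g fun x => |φ x|]
  rw [e2, e3]
  have haeN : ∀ᵐ x : EuclideanSpace ℝ (Fin d), x ∉ N := measure_eq_zero_iff_ae_notMem.1 hN
  have haeN' : ∀ᵐ x : EuclideanSpace ℝ (Fin d), x - t • e ∉ N :=
    (measurePreserving_sub_right volume (t • e)).quasiMeasurePreserving.ae haeN
  refine integral_mono_ae ?_ ?_ ?_
  · simp only [sub_mul]
    exact ((hshiftint (htrans hf t)).sub (hφ0 hf)).const_mul _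
  · simp only [add_mul]
    exact (hshiftint (ψ := fun x => |φ x|) (htrans' t)).add hφ0'
  filter_upwards [haeN, haeN'] with x hx hx'
  by_cases hxs : x ∈ tsupport φ
  · have hxS' : x - t • e ∈ S := by
      refine hεS (mem_cthickening_of_dist_le _ x _ _ hxs ?_)
      rw [dist_eq_norm, sub_sub_cancel_left, norm_neg, norm_smul, he, mul_one,
        Real.norm_of_nonneg ht0.le]
      exact ht.2
    have h1 := hfg _ ⟨hxS', hx'⟩ x ⟨hφS hxs, hx⟩
    rw [sub_sub_cancel_left, norm_neg, norm_smul, he, mul_one, Real.norm_of_nonneg ht0.le] at h1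
    rw [inv_mul_le_iff₀ ht0, ← mul_assoc]
    refine (le_abs_self _).trans ?_
    rw [abs_mul]
    gcongr
  · simp [image_eq_zero_of_notMem_tsupport hxs]

/-- A function with an integrable Hajłasz gradient has weak partial derivatives dominated by it. -/
theorem exists_weak_partial_of_hajlasz {S N : Set (EuclideanSpace ℝ (Fin d))} (hS : IsOpen S)
    (hN : volume N = 0) {f g : EuclideanSpace ℝ (Fin d) → ℝ} (hf : Integrable f)
    (hg : Integrable g) (hg0 : ∀ x, 0 ≤ g x)
    (hfg : ∀ x ∈ S \ N, ∀ y ∈ S \ N, |f x - f y| ≤ ‖x - y‖ * (g x + g y))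
    {e : EuclideanSpace ℝ (Fin d)} (he : ‖e‖ = 1) :
    ∃ h : EuclideanSpace ℝ (Fin d) → ℝ, AEStronglyMeasurable h ∧ (∀ᵐ x, |h x| ≤ 2 * g x) ∧
      ∀ φ : EuclideanSpace ℝ (Fin d) → ℝ, ContDiff ℝ (⊤ : ℕ∞) φ → HasCompactSupport φ →
      tsupport φ ⊆ S → ∫ x, f x * fderiv ℝ φ x e = - ∫ x, h x * φ x := by
  obtain ⟨G, hG, hG0, hgG⟩ := hg.aemeasurable.exists_measurable_nonneg (Eventually.of_forall hg0)
  set m : Measure (EuclideanSpace ℝ (Fin d)) := volume.withDensity fun x => ENNReal.ofReal (G x)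
  have hGm : Measurable fun x => ENNReal.ofReal (G x) := by fun_prop
  have hm : IsFiniteMeasure m := isFiniteMeasure_withDensity (hg.congr hgG).lintegral_lt_top.ne
  have hmint : ∀ F : EuclideanSpace ℝ (Fin d) → ℝ, ∫ x, F x ∂m = ∫ x, g x * F x := fun F => by
    rw [integral_withDensity_eq_integral_toReal_smul hGm (by simp)]
    refine integral_congr_ae ?_
    filter_upwards [hgG] with x hx
    rw [ENNReal.toReal_ofReal (hG0 x), hx, smul_eq_mul]
  let T : Submodule ℝ (EuclideanSpace ℝ (Fin d) → ℝ) :=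
    { carrier := {φ | ContDiff ℝ (⊤ : ℕ∞) φ ∧ HasCompactSupport φ ∧ tsupport φ ⊆ S}
      add_mem' := fun {φ ψ} hφ hψ => ⟨hφ.1.add hψ.1, hφ.2.1.add hψ.2.1,
        (tsupport_add φ ψ).trans (Set.union_subset hφ.2.2 hψ.2.2)⟩
      zero_mem' := ⟨contDiff_const, HasCompactSupport.zero, by simp⟩
      smul_mem' := fun c φ hφ => ⟨hφ.1.const_smul c, hφ.2.1.smul_left (f := fun _ => c),
        (tsupport_smul_subset_right (fun _ => c) φ).trans hφ.2.2⟩ }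
  have hint : ∀ φ : T, Integrable fun x => f x * fderiv ℝ φ.1 x e := fun φ => by
    obtain ⟨C, hC⟩ := (φ.2.2.1.fderiv_apply ℝ e).exists_bound_of_continuous
      ((φ.2.1.continuous_fderiv (by simp)).clm_apply continuous_const)
    exact hf.mul_bdd ((φ.2.1.continuous_fderiv (by simp)).clm_apply
      continuous_const).aestronglyMeasurable (Eventually.of_forall hC)
  have hdiff : ∀ (φ : T) x, DifferentiableAt ℝ φ.1 x := fun φ =>
    φ.2.1.differentiable (by simp)
  let l : T →ₗ[ℝ] ℝ :=
    { toFun := fun φ => ∫ x, f x * fderiv ℝ φ.1 x e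
      map_add' := fun φ ψ => by
        rw [← integral_add (hint φ) (hint ψ)]
        refine integral_congr_ae (Eventually.of_forall fun x => ?_)
        simp only [Submodule.coe_add]
        rw [fderiv_add (hdiff φ x) (hdiff ψ x), add_apply, mul_add]
      map_smul' := fun c φ => by
        rw [RingHom.id_apply, smul_eq_mul, ← integral_const_mul]
        refine integral_congr_ae (Eventually.of_forall fun x => ?_)
        simp only [Submodule.coe_smul]
        rw [fderiv_const_smul (hdiff φ x), smul_apply, smul_eq_mul]
        ring }
  obtain ⟨h, hh, hbound, hrep⟩ := exists_density_of_le_integral_abs (m := m) T.subtype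
    (fun φ => by
      obtain ⟨C, hC⟩ := φ.2.2.1.exists_bound_of_continuous φ.2.1.continuous
      exact MemLp.of_bound φ.2.1.continuous.aestronglyMeasurable C (Eventually.of_forall hC))
    l (C := 2) (fun φ => by
      rw [hmint]
      exact integral_mul_fderiv_le_of_hajlasz hS hN hf hg hfg φ.2.1 φ.2.2.1 φ.2.2.2 he)
    zero_le_two
  refine ⟨fun x => -(g x * h x), (hg.aestronglyMeasurable.mul hh.aestronglyMeasurable).neg, ?_,
    fun φ hφ hφc hφS => ?_⟩
  · filter_upwards [(ae_withDensity_iff hGm).1 hbound, hgG] with x hx hgx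
    rw [abs_neg, abs_mul, abs_of_nonneg (hg0 x), mul_comm 2]
    -- Where `g` vanishes the weighted measure says nothing about `h`, but the product `g * h` is
    -- zero.
    rcases (hg0 x).eq_or_lt with h0 | h0
    · simp [← h0]
    · refine mul_le_mul_of_nonneg_left (hx ?_) h0.le
      rw [← hgx]
      exact (ENNReal.ofReal_pos.2 h0).ne'
  · have := hrep ⟨φ, hφ, hφc, hφS⟩
    rw [hmint] at this
    refine this.trans ?_
    rw [← integral_neg]
    refine integral_congr_ae (Eventually.of_forall fun x => ?_)
    simp only [Submodule.subtype_apply]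
    ring

end HajlaszToSobolev

/-! ### Equality of the two Sobolev spaces on the domain. -/

section SobolevOnDomain

variable {d : ℕ} {S : Set (EuclideanSpace ℝ (Fin d))}

/-- The extension by zero of a function on a subset. -/
def zeroExtension {F : Type*} [Zero F] (u : S → F) : EuclideanSpace ℝ (Fin d) → F :=
  Function.extend Subtype.val u 0

theorem zeroExtension_coe {F : Type*} [Zero F] (u : S → F) (x : S) : zeroExtension u x = u x :=
  Subtype.val_injective.extend_apply _ _ _

theorem zeroExtension_of_notMem {F : Type*} [Zero F] (u : S → F) {x : EuclideanSpace ℝ (Fin d)}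
    (hx : x ∉ S) : zeroExtension u x = 0 :=
  Function.extend_apply' _ _ _ (by rintro ⟨y, rfl⟩; exact hx y.2)

theorem memLp_zeroExtension_iff (hS : MeasurableSet S) {F : Type*} [NormedAddCommGroup F]
    (u : S → F) {p : ENNReal} :
    MemLp (zeroExtension u) p volume ↔ MemLp u p (lebesgueOn S) := by
  have h1 : zeroExtension u = S.indicator (zeroExtension u) := by
    ext x
    by_cases hx : x ∈ S
    · simp [hx]
    · simp [hx, zeroExtension_of_notMem u hx]
  have h2 : zeroExtension u ∘ Subtype.val = u := funext (zeroExtension_coe u)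
  rw [h1, memLp_indicator_iff_restrict hS, ← map_comap_subtype_coe hS,
    (MeasurableEmbedding.subtype_coe hS).memLp_map_measure_iff, h2]
  rfl

theorem integral_lebesgueOn_eq (hS : MeasurableSet S) (F : EuclideanSpace ℝ (Fin d) → ℝ)
    (hF : ∀ x ∉ S, F x = 0) : ∫ x : S, F x ∂(lebesgueOn S) = ∫ x, F x := by
  rw [← setIntegral_eq_integral_of_forall_compl_eq_zero hF, ← map_comap_subtype_coe hS,
    (MeasurableEmbedding.subtype_coe hS).integral_map]
  rfl

theorem isFiniteMeasure_lebesgueOn (hS : MeasurableSet S) (hb : Bornology.IsBounded S) :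
    IsFiniteMeasure (lebesgueOn S) := by
  refine ⟨?_⟩
  rw [lebesgueOn, (MeasurableEmbedding.subtype_coe hS).comap_apply, Set.image_univ,
    Subtype.range_coe]
  exact hb.measure_lt_top

theorem lebesgueOn_preimage_eq_zero (hS : MeasurableSet S) {N : Set (EuclideanSpace ℝ (Fin d))}
    (hN : volume N = 0) : lebesgueOn S (Subtype.val ⁻¹' N) = 0 := by
  rw [lebesgueOn, (MeasurableEmbedding.subtype_coe hS).comap_apply]
  exact measure_mono_null (Set.image_preimage_subset _ _) hN

theorem volume_image_eq_zero (hS : MeasurableSet S) {N : Set S} (hN : lebesgueOn S N = 0) :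
    volume (Subtype.val '' N) = 0 := by
  rwa [lebesgueOn, (MeasurableEmbedding.subtype_coe hS).comap_apply] at hN

theorem edist_toReal_coe (x y : S) : (edist x y).toReal = ‖(x : EuclideanSpace ℝ (Fin d)) - y‖ := by
  rw [edist_dist, ENNReal.toReal_ofReal dist_nonneg, Subtype.dist_eq, dist_eq_norm]

/-- On a smooth bounded domain the Sobolev functions have a Hajłasz gradient. -/
theorem IsSmoothBoundedDomain.sobolevSpace_subset_hajlasz (hS : IsSmoothBoundedDomain S)
    {p : ENNReal} (hp : 1 < p) (hp_top : p ≠ ⊤) :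
    sobolevSpace S p ⊆ hajlaszSobolevSpace S (lebesgueOn S) p := by
  rintro u ⟨hu, g, hg, hug⟩
  have hSm := hS.isOpen.measurableSet
  have hfin := isFiniteMeasure_lebesgueOn hSm hS.isBounded
  have hint : ∀ {F : Type} [NormedAddCommGroup F] {v : S → F}, MemLp v p (lebesgueOn S) →
      Integrable (zeroExtension v) := fun hv =>
    memLp_one_iff_integrable.1 ((memLp_zeroExtension_iff hSm _).2 (hv.mono_exponent hp.le))
  obtain ⟨δ, hδ, N, m, hN, hm0, hm, hle⟩ := hS.exists_hajlasz_gradient hp hp_top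
    (hint hu) (hint hg) ((memLp_zeroExtension_iff hSm g).2 hg) (fun φ hφ hφc hφS i => by
      have h := hug φ hφ hφc hφS i
      rw [← integral_lebesgueOn_eq hSm _ fun x hx => by rw [zeroExtension_of_notMem u hx, zero_mul],
        ← integral_lebesgueOn_eq hSm _ fun x hx => by
          rw [zeroExtension_of_notMem g hx, PiLp.zero_apply, zero_mul]]
      simpa only [zeroExtension_coe] using h)
  -- The term `δ⁻¹ * |u x|` serves pairs at distance at least `δ`, for which `|u x| + |u y|` is a
  -- trivial bound.
  refine ⟨hu, hu.1.aemeasurable, Subtype.val ⁻¹' N, fun x => m x + δ⁻¹ * |u x|,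
    lebesgueOn_preimage_eq_zero hSm hN, fun x => add_nonneg (hm0 x) (by positivity), ?_,
    fun x hx y hy => ?_⟩
  · refine MemLp.add ?_ (hu.abs.const_mul _)
    have h1 : MemLp m p (volume.restrict S) := hm.restrict S
    rw [← map_comap_subtype_coe hSm] at h1
    exact (MeasurableEmbedding.subtype_coe hSm).memLp_map_measure_iff.1 h1
  · rw [edist_toReal_coe]
    rcases lt_or_ge ‖(x : EuclideanSpace ℝ (Fin d)) - y‖ δ with hxy | hxy
    · have h1 := hle x ⟨x.2, hx⟩ y ⟨y.2, hy⟩ hxy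
      rw [zeroExtension_coe, zeroExtension_coe] at h1
      refine h1.trans ?_
      gcongr
      all_goals exact le_add_of_nonneg_right (by positivity)
    · have h1 : 1 ≤ ‖(x : EuclideanSpace ℝ (Fin d)) - y‖ * δ⁻¹ := by
        rw [← div_eq_mul_inv]
        exact (one_le_div₀ hδ).2 hxy
      calc |u x - u y| ≤ 1 * (|u x| + |u y|) := by rw [one_mul]; exact abs_sub _ _
        _ ≤ ‖(x : EuclideanSpace ℝ (Fin d)) - y‖ * δ⁻¹ * (|u x| + |u y|) := by gcongr
        _ = ‖(x : EuclideanSpace ℝ (Fin d)) - y‖ * (δ⁻¹ * |u x| + δ⁻¹ * |u y|) := by ring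
        _ ≤ _ := by
          gcongr
          all_goals exact le_add_of_nonneg_left (hm0 _)

/-- Functions with a Hajłasz gradient on a bounded open set are Sobolev functions. -/
theorem hajlasz_subset_sobolevSpace (hS : IsOpen S) (hb : Bornology.IsBounded S)
    {p : ENNReal} (hp : 1 ≤ p) :
    hajlaszSobolevSpace S (lebesgueOn S) p ⊆ sobolevSpace S p := by
  rintro u ⟨hu, -, N, g, hN, hg0, hg, hug⟩
  have hu : MemLp u p (lebesgueOn S) := hu
  have hSm := hS.measurableSet
  have hfin := isFiniteMeasure_lebesgueOn hSm hb
  have hint : ∀ {v : S → ℝ}, MemLp v p (lebesgueOn S) → Integrable (zeroExtension v) := fun hv =>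
    memLp_one_iff_integrable.1 ((memLp_zeroExtension_iff hSm _).2 (hv.mono_exponent hp))
  have hG0 : ∀ x, 0 ≤ zeroExtension g x := fun x => by
    by_cases hx : x ∈ S
    · exact (zeroExtension_coe g ⟨x, hx⟩).symm ▸ hg0 _
    · rw [zeroExtension_of_notMem g hx]
  have hle : ∀ x ∈ S \ Subtype.val '' N, ∀ y ∈ S \ Subtype.val '' N,
      |zeroExtension u x - zeroExtension u y| ≤
        ‖x - y‖ * (zeroExtension g x + zeroExtension g y) := by
    rintro x ⟨hx, hxN⟩ y ⟨hy, hyN⟩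
    have h := hug ⟨x, hx⟩ (fun h => hxN ⟨_, h, rfl⟩) ⟨y, hy⟩ (fun h => hyN ⟨_, h, rfl⟩)
    rw [edist_toReal_coe] at h
    simpa only [← zeroExtension_coe] using h
  choose h hh hbound hrep using fun i : Fin d =>
    exists_weak_partial_of_hajlasz hS (volume_image_eq_zero hSm hN) (hint hu) (hint hg) hG0 hle
      (e := EuclideanSpace.single i 1) (by simp)
  have hhp : ∀ i, MemLp (h i) p volume := fun i =>
    (((memLp_zeroExtension_iff hSm g).2 hg).const_mul 2).mono' (hh i) (hbound i)
  refine ⟨hu, fun x => WithLp.toLp 2 fun i => h i x, MemLp.of_eval_piLp fun i => ?_,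
    fun φ hφ hφc hφS i => ?_⟩
  · have h1 : MemLp (h i) p (volume.restrict S) := (hhp i).restrict S
    rw [← map_comap_subtype_coe hSm] at h1
    exact (MeasurableEmbedding.subtype_coe hSm).memLp_map_measure_iff.1 h1
  · have hφ0 : ∀ x ∉ S, φ x = 0 := fun x hx =>
      image_eq_zero_of_notMem_tsupport fun h => hx (hφS h)
    have h1 := hrep i φ hφ hφc hφS
    rw [← integral_lebesgueOn_eq hSm _ fun x hx => by rw [zeroExtension_of_notMem u hx, zero_mul],
      ← integral_lebesgueOn_eq hSm _ fun x hx => by rw [hφ0 x hx, mul_zero]] at h1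
    simpa only [zeroExtension_coe] using h1

end SobolevOnDomain

/-! ### Invariance under bi-Lipschitz maps and comparable measures. -/

section Transfer

variable {X Y : Type*} [PseudoEMetricSpace X] [MeasurableSpace X] [PseudoEMetricSpace Y]
  [MeasurableSpace Y]

/-- Metric Sobolev spaces are preserved by Lipschitz changes of variables. -/
theorem comp_mem_hajlaszSobolevSpace {P : Measure X} (e : X ≃ᵐ Y) {L : ℝ} (hL0 : 0 ≤ L)
    (hL : ∀ x y, (edist (e x) (e y)).toReal ≤ L * (edist x y).toReal) {p : ENNReal} {f : Y → ℝ}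
    (hf : f ∈ hajlaszSobolevSpace Y (P.map e) p) : f ∘ e ∈ hajlaszSobolevSpace X P p := by
  obtain ⟨hfp, -, N, g, hN, hg0, hg, hle⟩ := hf
  have hfp : MemLp (f ∘ e) p P := e.measurableEmbedding.memLp_map_measure_iff.1 hfp
  have hgp : MemLp (g ∘ e) p P := e.measurableEmbedding.memLp_map_measure_iff.1 hg
  refine ⟨hfp, hfp.1.aemeasurable, e ⁻¹' N, fun x => L * g (e x), ?_,
    fun x => mul_nonneg hL0 (hg0 _), hgp.const_mul L, fun x hx y hy => ?_⟩
  · rwa [← e.map_apply]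
  · calc |f (e x) - f (e y)| ≤ (edist (e x) (e y)).toReal * (g (e x) + g (e y)) := hle _ hx _ hy
      _ ≤ L * (edist x y).toReal * (g (e x) + g (e y)) := by
        have := add_nonneg (hg0 (e x)) (hg0 (e y))
        gcongr
        exact hL x y
      _ = _ := by ring

theorem hajlaszSobolevSpace_map_eq {P : Measure X} (e : X ≃ᵐ Y) {L L' : ℝ} (hL0 : 0 ≤ L)
    (hL0' : 0 ≤ L') (hL : ∀ x y, (edist (e x) (e y)).toReal ≤ L * (edist x y).toReal)
    (hL' : ∀ x y, (edist x y).toReal ≤ L' * (edist (e x) (e y)).toReal) {p : ENNReal} :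
    hajlaszSobolevSpace Y (P.map e) p = {f | f ∘ e ∈ hajlaszSobolevSpace X P p} := by
  ext f
  refine ⟨comp_mem_hajlaszSobolevSpace e hL0 hL, fun hf => ?_⟩
  have h1 : f ∘ e ∈ hajlaszSobolevSpace X ((P.map e).map e.symm) p := by
    rwa [e.map_symm_map]
  have h2 := comp_mem_hajlaszSobolevSpace e.symm hL0' (fun x y => by
    simpa using hL' (e.symm x) (e.symm y)) h1
  rwa [Function.comp_assoc, e.self_comp_symm, Function.comp_id] at h2

/-- Comparable measures define the same metric Sobolev space. -/
theorem hajlaszSobolevSpace_subset_of_le_smul {P Q : Measure X} {c : ENNReal} (hc : c ≠ ⊤)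
    (hPQ : P ≤ c • Q) {p : ENNReal} : hajlaszSobolevSpace X Q p ⊆ hajlaszSobolevSpace X P p := by
  rintro f ⟨hf, -, N, g, hN, hg0, hg, hle⟩
  have hf : MemLp f p P := MemLp.of_measure_le_smul hc hPQ hf
  refine ⟨hf, hf.1.aemeasurable, N, g, ?_, hg0, MemLp.of_measure_le_smul hc hPQ hg, hle⟩
  refine le_antisymm ((hPQ N).trans ?_) bot_le
  rw [Measure.smul_apply, hN, smul_zero]

/-- A bi-Lipschitz bijection between Borel spaces is a measurable equivalence. -/
theorem exists_measurableEquiv_of_lipschitzWith [BorelSpace X] [BorelSpace Y] {E : X → Y}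
    (hE : Function.Bijective E) {L L' : NNReal} (hL : LipschitzWith L E)
    (hL' : AntilipschitzWith L' E) : ∃ e : X ≃ᵐ Y, ⇑e = E := by
  let h : X ≃ₜ Y :=
    { Equiv.ofBijective E hE with
      continuous_toFun := hL.continuous
      continuous_invFun :=
        (hL'.to_rightInverse (Equiv.ofBijective E hE).right_inv).continuous }
  exact ⟨h.toMeasurableEquiv, rfl⟩

end Transfer

/-- The bounds `c ≤ ρ ≤ C` make each measure at most a finite multiple of the other, so null sets
and `L^p` membership agree. -/
theorem HasBoundedLipschitzDensity.hajlaszSobolevSpace_eq {d : ℕ}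
    {S : Set (EuclideanSpace ℝ (Fin d))} {P : Measure S} (hP : HasBoundedLipschitzDensity P)
    (p : ENNReal) : hajlaszSobolevSpace S P p = hajlaszSobolevSpace S (lebesgueOn S) p := by
  obtain ⟨ρ, K, c, C, -, hc, hρ, rfl⟩ := hP
  refine Set.Subset.antisymm
    (hajlaszSobolevSpace_subset_of_le_smul (c := (ENNReal.ofReal c)⁻¹)
      (ENNReal.inv_ne_top.2 (ENNReal.ofReal_pos.2 hc).ne') ?_)
    (hajlaszSobolevSpace_subset_of_le_smul (c := ENNReal.ofReal C) ENNReal.ofReal_ne_top ?_)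
  · have h1 : ENNReal.ofReal c • lebesgueOn S ≤
        (lebesgueOn S).withDensity fun θ => ENNReal.ofReal (ρ θ) := by
      rw [← withDensity_const]
      exact withDensity_mono (Filter.Eventually.of_forall fun θ =>
        ENNReal.ofReal_le_ofReal (hρ θ).1)
    intro s
    rw [Measure.smul_apply, smul_eq_mul, mul_comm, ← div_eq_mul_inv,
      ENNReal.le_div_iff_mul_le (Or.inl (ENNReal.ofReal_pos.2 hc).ne')
        (Or.inl ENNReal.ofReal_ne_top), mul_comm]
    exact h1 s
  · rw [← withDensity_const]
    exact withDensity_mono (Filter.Eventually.of_forall fun θ =>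
      ENNReal.ofReal_le_ofReal (hρ θ).2)

end

theorem proposition3p4 {k d : ℕ} (hk : 1 ≤ k) (hd : 1 ≤ d)
    (Ω : Set (EuclideanSpace ℝ (Fin k))) (hΩ : IsSmoothBoundedDomain Ω)
    (Λ : Set (AcProb Ω))
    (S : Set (EuclideanSpace ℝ (Fin d))) (hS : IsSmoothBoundedDomain S)
    (E : S → Λ) (hE_surj : Function.Surjective E)
    (hE_lip : ∃ L : NNReal, LipschitzWith L E) (hE_anti : ∃ L : NNReal, AntilipschitzWith L E)
    (P_S : Measure S) (hP_S : IsProbabilityMeasure P_S)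
    (hP_S_density : HasBoundedLipschitzDensity P_S)
    (P_Λ : Measure Λ) (hP_Λ : P_Λ = P_S.map E)
    (hP_Λ_density : HasUniformlyBoundedLipschitzDensities (Subtype.val '' P_Λ.support))
    (p : ENNReal) (hp : 1 < p) (hp_top : p ≠ ⊤) :
    hajlaszSobolevSpace Λ P_Λ p = {f : Λ → ℝ | f ∘ E ∈ sobolevSpace S p} := by
  obtain ⟨L, hL⟩ := hE_lip
  obtain ⟨L', hL'⟩ := hE_anti
  obtain ⟨e, rfl⟩ := exists_measurableEquiv_of_lipschitzWith ⟨hL'.injective, hE_surj⟩ hL hL'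
  -- The Wasserstein distance is extended-valued and `toReal` sends `⊤` to `0`; finiteness on the
  -- image of `S` is needed before the antilipschitz bound passes to real numbers.
  have hfin : ∀ x y, edist (e x) (e y) ≠ ⊤ := fun x y =>
    ((hL x y).trans_lt (ENNReal.mul_lt_top ENNReal.coe_lt_top (edist_lt_top x y))).ne
  have hL_real : ∀ x y, (edist (e x) (e y)).toReal ≤ L * (edist x y).toReal := fun x y => by
    rw [← ENNReal.coe_toReal, ← ENNReal.toReal_mul]
    exact ENNReal.toReal_mono (ENNReal.mul_ne_top ENNReal.coe_ne_top (edist_ne_top x y)) (hL x y)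
  have hL_real' : ∀ x y, (edist x y).toReal ≤ L' * (edist (e x) (e y)).toReal := fun x y => by
    rw [← ENNReal.coe_toReal, ← ENNReal.toReal_mul]
    exact ENNReal.toReal_mono (ENNReal.mul_ne_top ENNReal.coe_ne_top (hfin x y)) (hL' x y)
  rw [hP_Λ, hajlaszSobolevSpace_map_eq e L.2 L'.2 hL_real hL_real',
    hP_S_density.hajlaszSobolevSpace_eq, Set.Subset.antisymm
      (hajlasz_subset_sobolevSpace hS.isOpen hS.isBounded hp.le)
      (hS.sobolevSpace_subset_hajlasz hp hp_top)]
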